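/- For $t>0$ and $x\in\mathbb{R}$ let $P(x,t)=\frac{1}{\pi}\,\frac{t}{x^2+t^2}$ be the one-dimensional Poisson kernel. Fix $\alpha\ge 0$ and, for a real- or complex-valued function $u_0$ on $\mathbb{R}$, define the non-tangential maximal function $$u^*(x)=\sup_{\substack{t>0\\ |y-x|\le \alpha t}} \int_{\mathbb{R}} P(y-z,t)\,|u_0(z)|\,dz ,\qquad x\in\mathbb{R}.$$ Then the following hold. (i) Let $1<p\le\infty$ and $u_0\in W^{1,p}(\mathbb{R})$. Then $u^*$ is finite everywhere, $u^*\in W^{1,p}(\mathbb{R})$, and $\|(u^*)'\|_{L^p(\mathbb{R})}\le\|u_0'\|_{L^p(\mathbb{R})}$, where the derivatives are weak derivatives. (ii) Let $u_0\in W^{1,1}(\mathbb{R})$. Then $u^*$ is finite everywhere, $u^*\in L^\infty(\mathbb{R})$, and $u^*$ has a weak derivative $(u^*)'$, which satisfies $\|(u^*)'\|_{L^1(\mathbb{R})}\le\|u_0'\|_{L^1(\mathbb{R})}$. (iii) Let $u_0$ be of bounded variation on $\mathbb{R}$. Then $u^*$ is finite everywhere, $u^*$ is of bounded variation on $\mathbb{R}$,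 and $V(u^*)\le V(u_0)$, where $V(f)$ denotes the total variation of $f$ on $\mathbb{R}$, that is, the supremum of $\sum_{n=1}^N|f(x_n)-f(x_{n-1})|$ over all finite sequences $x_0<x_1<\dots<x_N$. -/

import Mathlib

open MeasureTheory Set
open scoped ENNReal ContDiff

/-- The Poisson kernel of the upper half-plane, `P(x, t) = (1/π) · t / (x² + t²)`, for `t > 0`. -/
noncomputable def poissonKernel1D (x t : ℝ) : ℝ :=
  (1 / Real.pi) * (t / (x ^ 2 + t ^ 2))

/-- The Poisson extension `(P(·, t) * |u₀|)(y)`. The integrand is nonnegative, so that the integral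
is taken in `[0, ∞]`. -/
noncomputable def poissonExtension {E : Type*} [NormedAddCommGroup E]
    (u₀ : ℝ → E) (y t : ℝ) : ℝ≥0∞ :=
  ∫⁻ z, ENNReal.ofReal (poissonKernel1D (y - z) t) * ‖u₀ z‖ₑ

/-- The non-tangential Poisson maximal function with aperture `α`, with values in `[0, ∞]`:
the supremum of `P(·, t) * |u₀| (y)` over `t > 0` and `|y - x| ≤ α t`. -/
noncomputable def nontangentialMaximalENN {E : Type*} [NormedAddCommGroup E]
    (α : ℝ) (u₀ : ℝ → E) (x : ℝ) : ℝ≥0∞ :=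
  ⨆ (t : ℝ) (_ : 0 < t) (y : ℝ) (_ : |y - x| ≤ α * t), poissonExtension u₀ y t

/-- The same maximal function as a real-valued function (meaningful where it is finite). -/
noncomputable def nontangentialMaximal {E : Type*} [NormedAddCommGroup E]
    (α : ℝ) (u₀ : ℝ → E) (x : ℝ) : ℝ :=
  (nontangentialMaximalENN α u₀ x).toReal

/-- `v` is a weak derivative of `u` on the real line: both are locally integrable and
`∫ u φ' = - ∫ v φ` for all smooth compactly supported `φ`. -/
structure HasWeakDeriv {E : Type*} [NormedAddCommGroup E] [NormedSpace ℝ E]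
    (u v : ℝ → E) : Prop where
  locallyIntegrable : LocallyIntegrable u volume
  locallyIntegrable_deriv : LocallyIntegrable v volume
  integral_eq : ∀ φ : ℝ → ℝ, ContDiff ℝ ∞ φ → HasCompactSupport φ →
    ∫ x, deriv φ x • u x = - ∫ x, φ x • v x

/-- Membership in the Sobolev space `W^{1,p}(ℝ)`. -/
def MemW1p {E : Type*} [NormedAddCommGroup E] [NormedSpace ℝ E]
    (u : ℝ → E) (p : ℝ≥0∞) : Prop :=
  MemLp u p volume ∧ ∃ v : ℝ → E, HasWeakDeriv u v ∧ MemLp v p volume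

open Filter Topology
open scoped NNReal

/-! Let `f` be the modulus of the datum, cut down to compact support. Move the vertices of the cones
up to height `ε`, let `f_ε` be the Poisson integral of `f` at that height, and let `M` be the
resulting supremum over cones (`shiftedConeSup`). The core is a comparison principle. Suppose that
an affine function `l` dominates `f_ε` on `[a, b]` and dominates `M` at `a` and `b`. For `|β| ≤ α`
the function `l (x - β t)` is harmonic in `(x, t)`, so the maximum principle in the half-strip
between the parallel rays of slope `β` issuing from `a` and `b` bounds the Poisson integral along
the ray from `x` by `l x`. Taking all slopes gives `M ≤ l` on `[a, b]` (`shiftedConeSup_le_affine`).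
Hence `M` is convex wherever it is detached from `f_ε`.

Convexity on the detached set, together with decay at infinity, yields `∫ φ(M') ≤ ∫ φ(f_ε')` for
`φ(s) = (|s| - K)₊` and every `K ≥ 0` (`lintegral_truncAbs_deriv_le`). Poisson averaging does not
increase such integrals (Jensen), and they pass to the limit as `ε → 0` and the cut-off is removed
(Fatou). The family over all `K` serves three purposes: `K = 0` controls the variation and the `L¹`
norm, integration against `K ^ (p - 2)` recovers the `L^p` norm of the derivative, and `K → ∞` makes
the approximants equi-absolutely continuous, so that the limit is absolutely continuous and has a
weak derivative.

Three points are separate. For `p = ∞` a Lipschitz bound follows from translation invariance alone.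
Membership of the maximal function in `L^p`, `1 < p < ∞`, comes from a weak type `(1, 1)` estimate
and truncation. For bounded variation, the cut-off to `[-n, n]` adds the two jumps `f(±n)`; these
are recovered because the approximants descend to zero at infinity, while the maximal function stays
above a Poisson average that has the same limits as `f`. -/

/-! ### The Poisson kernel as a probability density. -/

theorem poissonKernel1D_nonneg (x : ℝ) {t : ℝ} (ht : 0 ≤ t) : 0 ≤ poissonKernel1D x t := by
  unfold poissonKernel1D
  have := Real.pi_pos
  positivity

theorem continuous_poissonKernel1D {t : ℝ} (ht : 0 < t) :
    Continuous fun x => poissonKernel1D x t := by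
  unfold poissonKernel1D
  refine continuous_const.mul (Continuous.div (by fun_prop) (by fun_prop) fun x => ?_)
  positivity

theorem poissonKernel1D_le (x : ℝ) {t : ℝ} (ht : 0 < t) :
    poissonKernel1D x t ≤ (1 / Real.pi) * (1 / t) := by
  unfold poissonKernel1D
  have := Real.pi_pos
  refine mul_le_mul_of_nonneg_left ?_ (by positivity)
  rw [div_le_div_iff₀ (by positivity) ht]
  nlinarith [sq_nonneg x]

theorem poissonKernel1D_eq_cauchyPDFReal (y z : ℝ) {t : ℝ} (ht : 0 < t) :
    poissonKernel1D (y - z) t = ProbabilityTheory.cauchyPDFReal y t.toNNReal z := by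
  rw [ProbabilityTheory.cauchyPDFReal_def, poissonKernel1D, Real.coe_toNNReal t ht.le,
    show (y - z) ^ 2 = (z - y) ^ 2 by ring]
  field_simp

theorem lintegral_poissonKernel1D (y : ℝ) {t : ℝ} (ht : 0 < t) :
    ∫⁻ z, ENNReal.ofReal (poissonKernel1D (y - z) t) = 1 := by
  simp_rw [poissonKernel1D_eq_cauchyPDFReal y _ ht]
  exact ProbabilityTheory.lintegral_cauchyPDF_eq_one (x₀ := y) (Real.toNNReal_pos.2 ht).ne'

theorem measurable_ofReal_poissonKernel1D (y : ℝ) {t : ℝ} (ht : 0 < t) :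
    Measurable fun z => ENNReal.ofReal (poissonKernel1D (y - z) t) :=
  ((continuous_poissonKernel1D ht).comp (continuous_const.sub continuous_id)).measurable.ennreal_ofReal

/-! ### Poisson averages and cone suprema of `[0, ∞]`-valued functions. -/

/-- The Poisson average of a `[0, ∞]`-valued function. -/
noncomputable def poissonAverage (F : ℝ → ℝ≥0∞) (y t : ℝ) : ℝ≥0∞ :=
  ∫⁻ z, ENNReal.ofReal (poissonKernel1D (y - z) t) * F z

/-- The non-tangential maximal function of a `[0, ∞]`-valued function. -/
noncomputable def coneSup (α : ℝ) (F : ℝ → ℝ≥0∞) (x : ℝ) : ℝ≥0∞ :=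
  ⨆ (t : ℝ) (_ : 0 < t) (y : ℝ) (_ : |y - x| ≤ α * t), poissonAverage F y t

theorem nontangentialMaximalENN_eq_coneSup {E : Type*} [NormedAddCommGroup E] (α : ℝ)
    (u : ℝ → E) (x : ℝ) : nontangentialMaximalENN α u x = coneSup α (fun z => ‖u z‖ₑ) x := rfl

theorem poissonAverage_mono_ae {F G : ℝ → ℝ≥0∞} (h : F ≤ᵐ[volume] G) (y t : ℝ) :
    poissonAverage F y t ≤ poissonAverage G y t :=
  lintegral_mono_ae (h.mono fun _ hz => mul_le_mul_right hz _)

theorem poissonAverage_const (c : ℝ≥0∞) (y : ℝ) {t : ℝ} (ht : 0 < t) :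
    poissonAverage (fun _ => c) y t = c := by
  unfold poissonAverage
  rw [lintegral_mul_const _ (measurable_ofReal_poissonKernel1D y ht),
    lintegral_poissonKernel1D y ht, one_mul]

theorem poissonAverage_add_const (F : ℝ → ℝ≥0∞) (c : ℝ≥0∞) (y : ℝ) {t : ℝ} (ht : 0 < t) :
    poissonAverage (fun z => F z + c) y t = poissonAverage F y t + c := by
  conv_rhs => rw [← poissonAverage_const c y ht]
  unfold poissonAverage
  simp_rw [mul_add]
  exact lintegral_add_right _ ((measurable_ofReal_poissonKernel1D y ht).mul_const c)

theorem poissonAverage_add_left (F : ℝ → ℝ≥0∞) (y h t : ℝ) :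
    poissonAverage F (y + h) t = poissonAverage (fun z => F (z + h)) y t := by
  unfold poissonAverage
  rw [← lintegral_add_right_eq_self _ h]
  simp

theorem poissonAverage_le_coneSup {α : ℝ} (F : ℝ → ℝ≥0∞) {x y t : ℝ} (ht : 0 < t)
    (hy : |y - x| ≤ α * t) : poissonAverage F y t ≤ coneSup α F x :=
  le_iSup₂_of_le t ht (le_iSup₂_of_le y hy le_rfl)

theorem coneSup_le {α : ℝ} {F : ℝ → ℝ≥0∞} {x : ℝ} {c : ℝ≥0∞}
    (h : ∀ t, 0 < t → ∀ y, |y - x| ≤ α * t → poissonAverage F y t ≤ c) : coneSup α F x ≤ c :=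
  iSup₂_le fun t ht => iSup₂_le fun y hy => h t ht y hy

theorem lt_coneSup_iff {α : ℝ} {F : ℝ → ℝ≥0∞} {x : ℝ} {c : ℝ≥0∞} :
    c < coneSup α F x ↔ ∃ t, 0 < t ∧ ∃ y, |y - x| ≤ α * t ∧ c < poissonAverage F y t := by
  simp only [coneSup, lt_iSup_iff, exists_prop]

theorem coneSup_mono_ae {α : ℝ} {F G : ℝ → ℝ≥0∞} (h : F ≤ᵐ[volume] G) (x : ℝ) :
    coneSup α F x ≤ coneSup α G x :=
  coneSup_le fun _ ht y hy =>
    (poissonAverage_mono_ae h y _).trans (poissonAverage_le_coneSup G ht hy)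

theorem coneSup_congr_ae {α : ℝ} {F G : ℝ → ℝ≥0∞} (h : F =ᵐ[volume] G) (x : ℝ) :
    coneSup α F x = coneSup α G x :=
  le_antisymm (coneSup_mono_ae h.le x) (coneSup_mono_ae h.symm.le x)

theorem coneSup_le_const {α : ℝ} {F : ℝ → ℝ≥0∞} {c : ℝ≥0∞} (h : ∀ᵐ z, F z ≤ c) (x : ℝ) :
    coneSup α F x ≤ c :=
  coneSup_le fun _ ht y _ => (poissonAverage_mono_ae h y _).trans (poissonAverage_const c y ht).le

theorem coneSup_add_const_le {α : ℝ} (F : ℝ → ℝ≥0∞) (c : ℝ≥0∞) (x : ℝ) :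
    coneSup α (fun z => F z + c) x ≤ coneSup α F x + c := by
  refine coneSup_le fun t ht y hy => ?_
  rw [poissonAverage_add_const F c y ht]
  gcongr
  exact poissonAverage_le_coneSup F ht hy

theorem coneSup_add_left (α : ℝ) (F : ℝ → ℝ≥0∞) (x h : ℝ) :
    coneSup α F (x + h) = coneSup α (fun z => F (z + h)) x := by
  apply le_antisymm
  · refine coneSup_le fun t ht y hy => ?_
    have : y = (y - h) + h := by ring
    rw [this, poissonAverage_add_left]
    exact poissonAverage_le_coneSup _ ht (by rwa [sub_sub, add_comm h x])
  · refine coneSup_le fun t ht y hy => ?_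
    rw [← poissonAverage_add_left]
    exact poissonAverage_le_coneSup _ ht (by rwa [add_sub_add_right_eq_sub])

/-! ### Poisson integrals as real parts of holomorphic functions. -/

/-- The Poisson integral of an integrable function. -/
noncomputable def poissonIntegral (f : ℝ → ℝ) (y t : ℝ) : ℝ :=
  ∫ z, poissonKernel1D (y - z) t * f z

/-- The Cauchy-type integral whose real part is the Poisson integral. -/
noncomputable def poissonCauchyIntegral (f : ℝ → ℝ) (w : ℂ) : ℂ :=
  ∫ z : ℝ, (f z : ℂ) * (((Real.pi : ℂ) * Complex.I)⁻¹ * ((z : ℂ) - w)⁻¹)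

theorem norm_ofReal_sub_inv_le (z : ℝ) {w : ℂ} (hw : 0 < w.im) : ‖((z : ℂ) - w)⁻¹‖ ≤ w.im⁻¹ := by
  rw [norm_inv]
  refine inv_anti₀ hw ?_
  have := Complex.abs_im_le_norm ((z : ℂ) - w)
  simp only [Complex.sub_im, Complex.ofReal_im, zero_sub, abs_neg] at this
  exact (le_abs_self _).trans this

theorem ofReal_sub_ne_zero (z : ℝ) {w : ℂ} (hw : 0 < w.im) : (z : ℂ) - w ≠ 0 := by
  intro h
  have := congrArg Complex.im h
  simp at this
  exact hw.ne' this

theorem integrable_poissonCauchyIntegrand {f : ℝ → ℝ} (hf : Integrable f) {w : ℂ}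
    (hw : 0 < w.im) :
    Integrable fun z : ℝ => (f z : ℂ) * (((Real.pi : ℂ) * Complex.I)⁻¹ * ((z : ℂ) - w)⁻¹) := by
  refine (hf.ofReal (𝕜 := ℂ)).mul_bdd (c := ‖((Real.pi : ℂ) * Complex.I)⁻¹‖ * w.im⁻¹) ?_ ?_
  · refine Continuous.aestronglyMeasurable (continuous_const.mul (Continuous.inv₀ (by fun_prop) ?_))
    exact fun z => ofReal_sub_ne_zero z hw
  · refine ae_of_all _ fun z => ?_
    rw [norm_mul]
    gcongr
    exact norm_ofReal_sub_inv_le z hw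

theorem re_poissonCauchyIntegral {f : ℝ → ℝ} (hf : Integrable f) {w : ℂ} (hw : 0 < w.im) :
    (poissonCauchyIntegral f w).re = poissonIntegral f w.re w.im := by
  unfold poissonCauchyIntegral poissonIntegral
  have := Complex.reCLM.integral_comp_comm (integrable_poissonCauchyIntegrand hf hw)
  simp only [Complex.reCLM_apply] at this
  rw [← this]
  refine integral_congr_ae (ae_of_all _ fun z => ?_)
  simp only [Complex.re_ofReal_mul, poissonKernel1D]
  rw [mul_comm]
  congr 1
  simp only [Complex.mul_re, Complex.inv_re, Complex.inv_im, Complex.normSq_apply, Complex.mul_im,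
    Complex.ofReal_re, Complex.ofReal_im, Complex.I_re, Complex.I_im, Complex.sub_re,
    Complex.sub_im]
  have e : (z - w.re) * (z - w.re) + (0 - w.im) * (0 - w.im) = (w.re - z) ^ 2 + w.im ^ 2 := by ring
  have h0 := Real.pi_pos
  have h1 : (w.re - z) ^ 2 + w.im ^ 2 ≠ 0 := by positivity
  rw [e]
  field_simp
  ring

/-- Differentiation under the integral sign. Only the size of the derivative matters later: it is
uniform on half-planes `ε ≤ im w`, which gives Lipschitz bounds there. -/
theorem exists_hasDerivAt_poissonCauchyIntegral {f : ℝ → ℝ} (hf : Integrable f) {w : ℂ}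
    (hw : 0 < w.im) :
    ∃ d, HasDerivAt (poissonCauchyIntegral f) d w ∧
      ‖d‖ ≤ (‖((Real.pi : ℂ) * Complex.I)⁻¹‖ * ∫ z, |f z|) * (w.im⁻¹) ^ 2 := by
  set κ := ((Real.pi : ℂ) * Complex.I)⁻¹ with hκ
  have himball : ∀ v ∈ Metric.ball w (w.im / 2), w.im / 2 < v.im := by
    intro v hv
    have h1 := Complex.abs_im_le_norm (v - w)
    rw [Metric.mem_ball, dist_eq_norm] at hv
    rw [Complex.sub_im] at h1
    have := (abs_lt.1 (h1.trans_lt hv)).1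
    linarith
  have hderiv : ∀ (z : ℝ) (v : ℂ), 0 < v.im →
      HasDerivAt (fun v => (f z : ℂ) * (κ * ((z : ℂ) - v)⁻¹))
        ((f z : ℂ) * (κ * (((z : ℂ) - v)⁻¹) ^ 2)) v := by
    intro z v hv
    have h1 : HasDerivAt (fun v : ℂ => (z : ℂ) - v) (-1) v := by
      simpa using (hasDerivAt_id v).const_sub (z : ℂ)
    have h2 := ((h1.inv (ofReal_sub_ne_zero z hv)).const_mul κ).const_mul (f z : ℂ)
    convert! h2 using 3
    field_simp [ofReal_sub_ne_zero z hv]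
  have hmeas : ∀ (v : ℂ), 0 < v.im → Continuous fun z : ℝ => ((z : ℂ) - v)⁻¹ := fun v hv =>
    Continuous.inv₀ (by fun_prop) fun z => ofReal_sub_ne_zero z hv
  have key := hasDerivAt_integral_of_dominated_loc_of_deriv_le (μ := volume)
    (F := fun v z => (f z : ℂ) * (κ * ((z : ℂ) - v)⁻¹))
    (F' := fun v z => (f z : ℂ) * (κ * (((z : ℂ) - v)⁻¹) ^ 2)) (x₀ := w)
    (bound := fun z => |f z| * (‖κ‖ * ((w.im / 2)⁻¹) ^ 2))
    (Metric.ball_mem_nhds w (half_pos hw)) ?_ (integrable_poissonCauchyIntegrand hf hw) ?_ ?_ ?_ ?_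
  · refine ⟨_, key.2, ?_⟩
    refine (norm_integral_le_of_norm_le (g := fun z => |f z| * (‖κ‖ * (w.im⁻¹) ^ 2))
      (hf.abs.mul_const _) (ae_of_all _ fun z => ?_)).trans ?_
    · rw [norm_mul, norm_mul, norm_pow, Complex.norm_real, Real.norm_eq_abs]
      gcongr
      exact norm_ofReal_sub_inv_le z hw
    · rw [integral_mul_const]
      apply le_of_eq
      ring
  · filter_upwards [Metric.ball_mem_nhds w (half_pos hw)] with v hv
    exact (integrable_poissonCauchyIntegrand hf
      ((half_pos hw).trans (himball v hv))).aestronglyMeasurable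
  · exact ((hf.ofReal (𝕜 := ℂ)).aestronglyMeasurable).mul
      (continuous_const.mul ((hmeas w hw).pow 2)).aestronglyMeasurable
  · refine ae_of_all _ fun z v hv => ?_
    rw [norm_mul, norm_mul, norm_pow, Complex.norm_real, Real.norm_eq_abs]
    have h1 := himball v hv
    gcongr
    refine (norm_ofReal_sub_inv_le z ((half_pos hw).trans h1)).trans ?_
    exact inv_anti₀ (half_pos hw) h1.le
  · exact hf.abs.mul_const _
  · exact ae_of_all _ fun z v hv => hderiv z v ((half_pos hw).trans (himball v hv))

theorem poissonIntegral_nonneg {f : ℝ → ℝ} (hf : ∀ z, 0 ≤ f z) (y : ℝ) {t : ℝ} (ht : 0 ≤ t) :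
    0 ≤ poissonIntegral f y t :=
  integral_nonneg fun z => mul_nonneg (poissonKernel1D_nonneg _ ht) (hf z)

theorem integrable_poissonKernel1D_mul {f : ℝ → ℝ} (hf : Integrable f) (y : ℝ) {t : ℝ}
    (ht : 0 < t) : Integrable fun z => poissonKernel1D (y - z) t * f z := by
  refine hf.bdd_mul (c := (1 / Real.pi) * (1 / t)) ?_ (ae_of_all _ fun z => ?_)
  · exact ((continuous_poissonKernel1D ht).comp
      (continuous_const.sub continuous_id)).aestronglyMeasurable
  · rw [Real.norm_eq_abs, abs_of_nonneg (poissonKernel1D_nonneg _ ht.le)]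
    exact poissonKernel1D_le _ ht

theorem abs_poissonIntegral_le {f : ℝ → ℝ} (hf : Integrable f) (y : ℝ) {t : ℝ} (ht : 0 < t) :
    |poissonIntegral f y t| ≤ (1 / Real.pi) * (1 / t) * ∫ z, |f z| := by
  rw [← integral_const_mul, ← Real.norm_eq_abs]
  refine norm_integral_le_of_norm_le (hf.abs.const_mul _) (ae_of_all _ fun z => ?_)
  rw [norm_mul, Real.norm_eq_abs, Real.norm_eq_abs, abs_of_nonneg (poissonKernel1D_nonneg _ ht.le)]
  gcongr
  exact poissonKernel1D_le _ ht

theorem poissonAverage_ofReal {f : ℝ → ℝ} (hf : Integrable f) (hf0 : ∀ z, 0 ≤ f z) (y : ℝ) {t : ℝ}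
    (ht : 0 < t) :
    poissonAverage (fun z => ENNReal.ofReal (f z)) y t = ENNReal.ofReal (poissonIntegral f y t) := by
  unfold poissonAverage poissonIntegral
  rw [ofReal_integral_eq_lintegral_ofReal (integrable_poissonKernel1D_mul hf y ht)
    (ae_of_all _ fun z => mul_nonneg (poissonKernel1D_nonneg _ ht.le) (hf0 z))]
  simp_rw [ENNReal.ofReal_mul (poissonKernel1D_nonneg _ ht.le)]

/-- The mean value inequality for the Cauchy-type integral on the convex half-plane `ε ≤ im w`. -/
theorem exists_lipschitz_poissonIntegral {f : ℝ → ℝ} (hf : Integrable f) {ε : ℝ} (hε : 0 < ε) :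
    ∃ C : ℝ, 0 ≤ C ∧ ∀ y y' t t', ε ≤ t → ε ≤ t' →
      |poissonIntegral f y t - poissonIntegral f y' t'| ≤ C * (|y - y'| + |t - t'|) := by
  set C := (‖((Real.pi : ℂ) * Complex.I)⁻¹‖ * ∫ z, |f z|) * (ε⁻¹) ^ 2 with hC
  have hC0 : 0 ≤ C := mul_nonneg (mul_nonneg (norm_nonneg _)
    (integral_nonneg fun _ => abs_nonneg _)) (sq_nonneg _)
  refine ⟨C, hC0, fun y y' t t' ht ht' => ?_⟩
  have hconv : Convex ℝ {w : ℂ | ε ≤ w.im} := convex_halfSpace_im_ge ε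
  choose! d hd hdn using fun (w : ℂ) (hw : 0 < w.im) => exists_hasDerivAt_poissonCauchyIntegral hf hw
  have key := hconv.norm_image_sub_le_of_norm_hasDerivWithin_le (C := C)
    (f := poissonCauchyIntegral f) (f' := d) (x := ⟨y', t'⟩) (y := ⟨y, t⟩)
    (fun w hw => (hd w (hε.trans_le hw)).hasDerivWithinAt)
    (fun w hw => (hdn w (hε.trans_le hw)).trans ?_) ht' ht
  · have h1 := (Complex.abs_re_le_norm _).trans key
    rw [Complex.sub_re, re_poissonCauchyIntegral hf (hε.trans_le ht),
      re_poissonCauchyIntegral hf (hε.trans_le ht')] at h1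
    refine h1.trans (mul_le_mul_of_nonneg_left ?_ hC0)
    exact (Complex.norm_le_abs_re_add_abs_im _).trans (by simp)
  · rw [hC]
    have : ε ≤ w.im := hw
    have h2 : 0 ≤ w.im⁻¹ := inv_nonneg.2 (hε.le.trans this)
    gcongr

/-! ### The comparison principle for cones with vertices at height `ε`. -/

/-- The foot `re w - β * im w` of the ray of slope `β` through `w` is the real part of `(1 + β i)
w`. An affine function of the foot is therefore harmonic, and the maximum principle applies in the
sheared half-strip. The strip is unbounded upwards, so a small multiple of the height is subtracted
first, as in Phragmén–Lindelöf arguments. -/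
theorem poissonIntegral_le_affine_of_sheared_strip {f : ℝ → ℝ} (hf : Integrable f) {ε : ℝ}
    (hε : 0 < ε) {a b c s β : ℝ}
    (hbot : ∀ x ∈ Icc a b, poissonIntegral f x ε ≤ c + s * x)
    (hleft : ∀ t, 0 ≤ t → poissonIntegral f (a + β * t) (t + ε) ≤ c + s * a)
    (hright : ∀ t, 0 ≤ t → poissonIntegral f (b + β * t) (t + ε) ≤ c + s * b)
    {x t : ℝ} (hx : x ∈ Icc a b) (ht : 0 ≤ t) :
    poissonIntegral f (x + β * t) (t + ε) ≤ c + s * x := by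
  rcases hx.1.eq_or_lt with rfl | hax
  · exact hleft t ht
  rcases hx.2.eq_or_lt with rfl | hxb
  · exact hright t ht
  rcases ht.eq_or_lt with rfl | ht0
  · simpa using hbot x hx
  obtain ⟨B, hB⟩ : ∃ B, ∀ y t, ε ≤ t → poissonIntegral f y t ≤ B := by
    refine ⟨(1 / Real.pi) * (1 / ε) * ∫ z, |f z|, fun y t ht => (le_abs_self _).trans
      ((abs_poissonIntegral_le hf y (hε.trans_le ht)).trans ?_)⟩
    have := Real.pi_pos
    gcongr
  set D := |c| + |s| * (|a| + |b|) with hD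
  have hDle : ∀ x ∈ Icc a b, -D ≤ c + s * x := by
    intro x hx
    have h1 : |x| ≤ |a| + |b| := by
      rw [abs_le]
      constructor <;> cases abs_cases a <;> cases abs_cases b <;> linarith [hx.1, hx.2]
    have h2 : |s * x| ≤ |s| * (|a| + |b|) := by rw [abs_mul]; gcongr
    linarith [neg_abs_le c, neg_abs_le (s * x)]
  refine le_of_forall_pos_le_add fun δ hδ => ?_
  -- The penalty `η * im w` costs exactly `δ` at the point under consideration.
  set η := δ / t with hη
  have hη0 : 0 < η := by positivity
  -- The strip is cut at a height where the penalty `η * T` exceeds `B + D`, the largest possible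
  -- excess of the Poisson integral over the affine function.
  set T := t + 1 + |B + D| / η with hT
  have hTt : t < T := by
    have : 0 ≤ |B + D| / η := by positivity
    linarith
  have hTB : B + D ≤ η * T := by
    have : η * (|B + D| / η) = |B + D| := by field_simp
    have h2 : 0 < η * (t + 1) := by positivity
    rw [hT, mul_add]
    linarith [le_abs_self (B + D)]
  set S : Set ℂ := {w | a < w.re - β * w.im ∧ w.re - β * w.im < b ∧ 0 < w.im ∧ w.im < T} with hS
  set S' : Set ℂ := {w | a ≤ w.re - β * w.im ∧ w.re - β * w.im ≤ b ∧ 0 ≤ w.im ∧ w.im ≤ T} with hS'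
  have hc1 : Continuous fun w : ℂ => w.re - β * w.im := by fun_prop
  have hSo : IsOpen S :=
    (isOpen_lt continuous_const hc1).inter ((isOpen_lt hc1 continuous_const).inter
      ((isOpen_lt continuous_const Complex.continuous_im).inter
        (isOpen_lt Complex.continuous_im continuous_const)))
  have hS'c : IsClosed S' :=
    (isClosed_le continuous_const hc1).inter ((isClosed_le hc1 continuous_const).inter
      ((isClosed_le continuous_const Complex.continuous_im).inter
        (isClosed_le Complex.continuous_im continuous_const)))
  have hcl : closure S ⊆ S' := closure_minimal
    (fun w hw => ⟨hw.1.le, hw.2.1.le, hw.2.2.1.le, hw.2.2.2.le⟩) hS'c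
  have hbdd : Bornology.IsBounded S := by
    rw [isBounded_iff_forall_norm_le]
    refine ⟨(|a| + |b| + |β| * T) + T, fun w hw => (Complex.norm_le_abs_re_add_abs_im w).trans ?_⟩
    obtain ⟨h1, h2, h3, h4⟩ := hw
    have h5 : |w.im| ≤ T := by rw [abs_of_pos h3]; exact h4.le
    have h6 : |β * w.im| ≤ |β| * T := by rw [abs_mul]; gcongr
    have h7 : |w.re - β * w.im| ≤ |a| + |b| := by
      rw [abs_le]
      constructor <;> cases abs_cases a <;> cases abs_cases b <;> linarith
    have h8 : |w.re| ≤ |w.re - β * w.im| + |β * w.im| := by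
      have := abs_add_le (w.re - β * w.im) (β * w.im)
      rwa [sub_add_cancel] at this
    linarith
  -- The real part of `L` is the Poisson integral minus the affine majorant minus the penalty. It is
  -- nonpositive on the frontier, so the maximum modulus principle for `exp L` makes it nonpositive
  -- inside.
  set L : ℂ → ℂ := fun w => poissonCauchyIntegral f (w + ε * Complex.I)
    - (c + s * ((1 + β * Complex.I) * w)) + η * (Complex.I * w) with hL
  have hre : ∀ w : ℂ, 0 ≤ w.im → (L w).re =
      poissonIntegral f w.re (w.im + ε) - (c + s * (w.re - β * w.im)) - η * w.im := by
    intro w hw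
    have h1 : 0 < (w + ε * Complex.I).im := by simp; linarith
    simp only [hL, Complex.add_re, Complex.sub_re, re_poissonCauchyIntegral hf h1]
    simp
    ring
  have hdiff : DifferentiableOn ℂ (fun w => Complex.exp (L w)) (closure S) := by
    intro w hw
    have h0 : 0 ≤ w.im := (hcl hw).2.2.1
    have h1 : 0 < (w + ε * Complex.I).im := by simp; linarith
    obtain ⟨d, hd, -⟩ := exists_hasDerivAt_poissonCauchyIntegral hf h1
    have h2 : DifferentiableAt ℂ (fun w => poissonCauchyIntegral f (w + ε * Complex.I)) w :=
      DifferentiableAt.fun_comp' (g := poissonCauchyIntegral f) w hd.differentiableAt (by fun_prop)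
    exact DifferentiableAt.differentiableWithinAt (by simp only [hL]; fun_prop)
  have hfr : ∀ w ∈ frontier S, ‖Complex.exp (L w)‖ ≤ 1 := by
    intro w hw
    rw [hSo.frontier_eq] at hw
    obtain ⟨h1, h2, h3, h4⟩ := hcl hw.1
    rw [Complex.norm_exp, Real.exp_le_one_iff, hre w h3]
    have hη1 : 0 ≤ η * w.im := by positivity
    have hwre : w.re = (w.re - β * w.im) + β * w.im := by ring
    by_cases e1 : w.re - β * w.im = a
    · have := hleft w.im h3
      rw [← e1, ← hwre] at this
      linarith
    by_cases e2 : w.re - β * w.im = b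
    · have := hright w.im h3
      rw [← e2, ← hwre] at this
      linarith
    by_cases e3 : w.im = 0
    · have := hbot w.re (by rw [e3] at h1 h2; simpa using And.intro h1 h2)
      simp only [e3, zero_add, mul_zero, sub_zero]
      linarith
    have e4 : w.im = T := by
      by_contra e4
      exact hw.2 ⟨lt_of_le_of_ne h1 (Ne.symm e1), lt_of_le_of_ne h2 e2,
        lt_of_le_of_ne h3 (Ne.symm e3), lt_of_le_of_ne h4 e4⟩
    have h5 := hB w.re (w.im + ε) (by linarith)
    have h6 := hDle _ ⟨h1, h2⟩
    have h7 : η * w.im = η * T := by rw [e4]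
    linarith
  have hw : (⟨x + β * t, t⟩ : ℂ) ∈ closure S := by
    refine subset_closure ⟨?_, ?_, ht0, hTt⟩ <;> simpa
  have key := Complex.norm_le_of_forall_mem_frontier_norm_le hbdd hdiff.diffContOnCl hfr hw
  rw [Complex.norm_exp, Real.exp_le_one_iff, hre _ ht] at key
  simp only [add_sub_cancel_right] at key
  have : η * t = δ := by rw [hη]; field_simp
  linarith

/-- The non-tangential maximal function of the Poisson integral over cones with vertices at
height `ε`. -/
noncomputable def shiftedConeSup (α ε : ℝ) (f : ℝ → ℝ) (x : ℝ) : ℝ :=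
  ⨆ c : {c : ℝ × ℝ // 0 ≤ c.2 ∧ |c.1| ≤ α * c.2}, poissonIntegral f (x + c.1.1) (c.1.2 + ε)

instance (α : ℝ) : Nonempty {c : ℝ × ℝ // 0 ≤ c.2 ∧ |c.1| ≤ α * c.2} := ⟨⟨(0, 0), by simp⟩⟩

section
variable {f : ℝ → ℝ} {α ε : ℝ}

theorem bddAbove_range_poissonIntegral (hf : Integrable f) (hε : 0 < ε) (x : ℝ) :
    BddAbove (range fun c : {c : ℝ × ℝ // 0 ≤ c.2 ∧ |c.1| ≤ α * c.2} =>
      poissonIntegral f (x + c.1.1) (c.1.2 + ε)) := by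
  refine ⟨(1 / Real.pi) * (1 / ε) * ∫ z, |f z|, ?_⟩
  rintro _ ⟨⟨⟨s, t⟩, ht, hs⟩, rfl⟩
  have ht' : ε ≤ t + ε := by simpa using ht
  refine (le_abs_self _).trans ((abs_poissonIntegral_le hf _ (hε.trans_le ht')).trans ?_)
  have := Real.pi_pos
  have h2 : 0 ≤ ∫ z, |f z| := integral_nonneg fun _ => abs_nonneg _
  gcongr

theorem poissonIntegral_le_shiftedConeSup (hf : Integrable f) (hε : 0 < ε) (x : ℝ) {s t : ℝ}
    (ht : 0 ≤ t) (hs : |s| ≤ α * t) : poissonIntegral f (x + s) (t + ε) ≤ shiftedConeSup α ε f x :=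
  le_ciSup (bddAbove_range_poissonIntegral (α := α) hf hε x) ⟨(s, t), ht, hs⟩

theorem poissonIntegral_le_shiftedConeSup_self (hf : Integrable f) (hε : 0 < ε) (x : ℝ) :
    poissonIntegral f x ε ≤ shiftedConeSup α ε f x := by
  simpa using poissonIntegral_le_shiftedConeSup (α := α) (s := 0) (t := 0) hf hε x le_rfl (by simp)

theorem shiftedConeSup_le {x c : ℝ}
    (h : ∀ s t, 0 ≤ t → |s| ≤ α * t → poissonIntegral f (x + s) (t + ε) ≤ c) :
    shiftedConeSup α ε f x ≤ c :=
  ciSup_le fun ⟨⟨s, t⟩, ht, hs⟩ => h s t ht hs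

theorem exists_lipschitzWith_poissonIntegral_shiftedConeSup (hf : Integrable f) (hε : 0 < ε) :
    ∃ C : ℝ≥0, LipschitzWith C (fun x => poissonIntegral f x ε) ∧
      LipschitzWith C (shiftedConeSup α ε f) := by
  obtain ⟨C, hC, h⟩ := exists_lipschitz_poissonIntegral hf hε
  lift C to ℝ≥0 using hC
  refine ⟨C, LipschitzWith.of_dist_le_mul fun x y => ?_,
    LipschitzWith.of_le_add_mul _ fun x y => ?_⟩
  · simpa [Real.dist_eq] using h x y ε ε le_rfl le_rfl
  · refine shiftedConeSup_le fun s t ht hs => ?_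
    have ht' : ε ≤ t + ε := by simpa using ht
    have h1 := (abs_le.1 (h (x + s) (y + s) (t + ε) (t + ε) ht' ht')).2
    have h2 := poissonIntegral_le_shiftedConeSup (α := α) hf hε y ht hs
    simp only [add_sub_add_right_eq_sub, sub_self, abs_zero, add_zero] at h1
    rw [Real.dist_eq]
    linarith

/-- The comparison principle: below an affine majorant of the boundary values. -/
theorem shiftedConeSup_le_affine (hf : Integrable f) (hε : 0 < ε) {a b c s : ℝ}
    (hbot : ∀ x ∈ Icc a b, poissonIntegral f x ε ≤ c + s * x)
    (hleft : shiftedConeSup α ε f a ≤ c + s * a) (hright : shiftedConeSup α ε f b ≤ c + s * b)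
    {x : ℝ} (hx : x ∈ Icc a b) : shiftedConeSup α ε f x ≤ c + s * x := by
  refine shiftedConeSup_le fun r t ht hr => ?_
  rcases ht.eq_or_lt with rfl | ht0
  · have : r = 0 := by simpa using hr
    simpa [this] using hbot x hx
  have hβ : ∀ τ, 0 ≤ τ → |r / t * τ| ≤ α * τ := by
    intro τ hτ
    rw [abs_mul, abs_div, abs_of_pos ht0, abs_of_nonneg hτ]
    gcongr
    rwa [div_le_iff₀ ht0]
  -- Each point of the cone over `x` lies on a ray of slope `r / t`, and the parallel rays from `a`
  -- and `b` stay in the cones over `a` and `b`.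
  have := poissonIntegral_le_affine_of_sheared_strip hf hε (β := r / t) hbot
    (fun τ hτ => (poissonIntegral_le_shiftedConeSup hf hε a hτ (hβ τ hτ)).trans hleft)
    (fun τ hτ => (poissonIntegral_le_shiftedConeSup hf hε b hτ (hβ τ hτ)).trans hright) hx ht
  rwa [div_mul_cancel₀ _ ht0.ne'] at this

theorem ofReal_shiftedConeSup_le_coneSup (hf : Integrable f) (hf0 : ∀ z, 0 ≤ f z) (hα : 0 ≤ α)
    (hε : 0 < ε) (x : ℝ) : ENNReal.ofReal (shiftedConeSup α ε f x) ≤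
      coneSup α (fun z => ENNReal.ofReal (f z)) x := by
  by_cases htop : coneSup α (fun z => ENNReal.ofReal (f z)) x = ⊤
  · simp [htop]
  refine ENNReal.ofReal_le_of_le_toReal (shiftedConeSup_le fun s t ht hs => ?_)
  rw [← ENNReal.ofReal_le_iff_le_toReal htop, ← poissonAverage_ofReal hf hf0 _ (by positivity)]
  refine poissonAverage_le_coneSup _ (by positivity) ?_
  rw [add_sub_cancel_left]
  nlinarith

/-- A point of the cone over a distant `x` is either horizontally far from the support or high above
it; the kernel is `O(1 / |x|)` in both cases. -/
theorem shiftedConeSup_le_div (hf : Integrable f) (hf0 : ∀ z, 0 ≤ f z) {A : ℝ}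
    (hA : ∀ z, A < |z| → f z = 0) (hα : 0 ≤ α) (hε : 0 < ε) {x : ℝ} (hx : 2 * A < |x|)
    (hA0 : 0 ≤ A) :
    shiftedConeSup α ε f x ≤ ((1 + 2 * α) * ∫ z, f z) / (|x| - 2 * A) := by
  have hpos : 0 < |x| - 2 * A := by linarith
  have hpi := Real.pi_pos
  refine shiftedConeSup_le fun s t ht hs => ?_
  set τ := t + ε with hτ
  have hτ0 : 0 < τ := by positivity
  have hs' : |s| ≤ α * τ := by nlinarith
  have hker : ∀ z, |z| ≤ A →
      poissonKernel1D (x + s - z) τ ≤ (1 + 2 * α) / (|x| - 2 * A) := by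
    intro z hz
    have hy : |x| - α * τ - A ≤ |x + s - z| := by
      have h1 := abs_sub_abs_le_abs_sub x (z - s)
      have h2 := abs_sub z s
      rw [show x - (z - s) = x + s - z by ring] at h1
      linarith
    have hk : poissonKernel1D (x + s - z) τ ≤ τ / ((x + s - z) ^ 2 + τ ^ 2) := by
      unfold poissonKernel1D
      refine mul_le_of_le_one_left (by positivity) ?_
      rw [div_le_one hpi]
      linarith [Real.pi_gt_three]
    refine hk.trans ?_
    rw [div_le_div_iff₀ (by positivity) hpos]
    set r := |x + s - z| with hr
    have hr0 : 0 ≤ r := abs_nonneg _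
    have hr2 : (x + s - z) ^ 2 = r ^ 2 := (sq_abs _).symm
    rw [hr2]
    have h3 : |x| - 2 * A ≤ 2 * r + 2 * α * τ := by linarith
    calc τ * (|x| - 2 * A) ≤ τ * (2 * r + 2 * α * τ) := by gcongr
      _ ≤ (1 + 2 * α) * (r ^ 2 + τ ^ 2) := by
        nlinarith [sq_nonneg (r - τ), mul_nonneg hα (sq_nonneg r)]
  unfold poissonIntegral
  calc ∫ z, poissonKernel1D (x + s - z) τ * f z
      ≤ ∫ z, (1 + 2 * α) / (|x| - 2 * A) * f z := by
        refine integral_mono (integrable_poissonKernel1D_mul hf _ hτ0) (hf.const_mul _) fun z => ?_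
        by_cases hz : A < |z|
        · simp [hA z hz]
        · exact mul_le_mul_of_nonneg_right (hker z (not_lt.1 hz)) (hf0 z)
    _ = _ := by rw [integral_const_mul]; ring

theorem exists_shiftedConeSup_lt (hf : Integrable f) (hf0 : ∀ z, 0 ≤ f z) {A : ℝ}
    (hA : ∀ z, A < |z| → f z = 0) (hα : 0 ≤ α) (hε : 0 < ε) {δ : ℝ} (hδ : 0 < δ) :
    ∃ R, 0 < R ∧ ∀ x, R < |x| → shiftedConeSup α ε f x < δ := by
  have hA' : ∀ z, max A 0 < |z| → f z = 0 := fun z hz => hA z ((le_max_left _ _).trans_lt hz)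
  have hA0 : 0 ≤ max A 0 := le_max_right _ _
  have hI : 0 ≤ (1 + 2 * α) * ∫ z, f z := mul_nonneg (by positivity) (integral_nonneg hf0)
  refine ⟨2 * max A 0 + ((1 + 2 * α) * ∫ z, f z) / δ + 1, by positivity, fun x hx => ?_⟩
  have h1 : 0 ≤ ((1 + 2 * α) * ∫ z, f z) / δ := by positivity
  refine (shiftedConeSup_le_div hf hf0 hA' hα hε (by linarith) hA0).trans_lt ?_
  rw [div_lt_iff₀ (by linarith), mul_comm δ, ← div_lt_iff₀ hδ]
  linarith

end

/-! ### Majorization of derivatives from the comparison principle. -/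

/-- The convex function `s ↦ (|s| - K)₊`. -/
noncomputable def truncAbs (K s : ℝ) : ℝ := max (|s| - K) 0

/-- A monotone selection of the subdifferential of `truncAbs K`. -/
noncomputable def truncSign (K s : ℝ) : ℝ := if K < s then 1 else if s < -K then -1 else 0

theorem truncAbs_nonneg (K s : ℝ) : 0 ≤ truncAbs K s := le_max_right _ _

theorem continuous_truncAbs (K : ℝ) : Continuous (truncAbs K) :=
  (continuous_abs.sub continuous_const).max continuous_const

theorem truncAbs_le_abs {K : ℝ} (hK : 0 ≤ K) (s : ℝ) : truncAbs K s ≤ |s| :=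
  max_le (by linarith) (abs_nonneg s)

/-- The subgradient inequality, with the slope taken at `a`. -/
theorem truncAbs_le_add {K : ℝ} (hK : 0 ≤ K) (a b : ℝ) :
    truncAbs K a ≤ truncAbs K b + truncSign K a * (a - b) := by
  unfold truncAbs truncSign
  have h1 := le_max_left (|b| - K) 0
  have h2 := le_max_right (|b| - K) 0
  have h3 := le_abs_self b
  have h4 := neg_abs_le b
  split_ifs with ha hb
  · rw [abs_of_pos (hK.trans_lt ha)]
    exact max_le (by linarith) (by linarith)
  · rw [abs_of_neg (hb.trans_le (by linarith))]
    exact max_le (by linarith) (by linarith)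
  · have : |a| ≤ K := abs_le.2 ⟨by linarith, by linarith⟩
    exact max_le (by linarith) (by linarith)

theorem truncSign_mono {K : ℝ} (hK : 0 ≤ K) : Monotone (truncSign K) := by
  intro a b hab
  unfold truncSign
  split_ifs <;> linarith [hK]

theorem abs_truncSign_le (K s : ℝ) : |truncSign K s| ≤ 1 := by
  unfold truncSign
  split_ifs <;> simp

section
variable {f M : ℝ → ℝ} {L : ℝ≥0}

theorem LipschitzWith.abs_sub_le {f : ℝ → ℝ} (hf : LipschitzWith L f) (x y : ℝ) :
    |f x - f y| ≤ L * |x - y| := by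
  simpa [Real.dist_eq] using hf.dist_le_mul x y

/-- A discrete form of convexity on the detached set. If `M x` lay above the chord of `M` over `[x -
h, x + h]`, the comparison principle would force `f` above the chord at some `z`. Going back from
`z` to `x` costs `L h` for `f`, `L h` for `M`, and `2 L h + 2 L h` for the distance between `M` and
its chord at `z`, which is the constant 6. -/
theorem midpoint_le_of_detached (hf : LipschitzWith L f) (hM : LipschitzWith L M)
    (hcomp : ∀ a b c s, (∀ x ∈ Icc a b, f x ≤ c + s * x) → M a ≤ c + s * a → M b ≤ c + s * b →
      ∀ x ∈ Icc a b, M x ≤ c + s * x)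
    {x h : ℝ} (hh : 0 < h) (hx : 6 * L * h < M x - f x) : 2 * M x ≤ M (x + h) + M (x - h) := by
  by_contra! hcon
  set s := (M (x + h) - M (x - h)) / (2 * h) with hs
  set c := M (x - h) - s * (x - h) with hc
  have hsh : s * (2 * h) = M (x + h) - M (x - h) := by rw [hs]; field_simp
  have hsL : |s| ≤ L := by
    rw [hs, abs_div, abs_of_pos (by positivity : 0 < 2 * h), div_le_iff₀ (by positivity)]
    have := hM.abs_sub_le (x + h) (x - h)
    rwa [show x + h - (x - h) = 2 * h by ring, abs_of_pos (by positivity : 0 < 2 * h)] at this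
  obtain ⟨z, hz, hfz⟩ : ∃ z ∈ Icc (x - h) (x + h), c + s * z < f z := by
    by_contra! hno
    have := hcomp (x - h) (x + h) c s hno (by rw [hc]; linarith) (by rw [hc]; linarith) x
      ⟨by linarith, by linarith⟩
    rw [hc] at this
    linarith
  have h1 := (abs_le.1 (hM.abs_sub_le z (x - h))).2
  rw [abs_of_nonneg (by linarith [hz.1] : 0 ≤ z - (x - h))] at h1
  have h2 : -(L * (z - (x - h))) ≤ s * (z - (x - h)) := by
    nlinarith [(abs_le.1 hsL).1, hz.1]
  have h3 : (L : ℝ) * (z - (x - h)) ≤ L * (2 * h) := by gcongr; linarith [hz.2]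
  have h4 : (L : ℝ) * |x - z| ≤ L * h := by
    gcongr
    rw [abs_le]
    constructor <;> linarith [hz.1, hz.2]
  have h5 := (abs_le.1 (hM.abs_sub_le x z)).2
  have h6 := (abs_le.1 (hf.abs_sub_le x z)).1
  have h7 : s * z = s * (z - (x - h)) + s * (x - h) := by ring
  rw [hc] at hfz
  linarith

/-- Summation by parts: translating by `h` turns the integral into that of `(G (x - h) - G x) * g
x`. Monotonicity of `G` is needed only where `g` is positive. -/
theorem integral_mul_shift_sub_nonpos {G g : ℝ → ℝ} (hG : Measurable G) (hG1 : ∀ x, |G x| ≤ 1)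
    (hg : Integrable g) (hg0 : ∀ x, 0 ≤ g x) {h : ℝ}
    (hmono : ∀ x, 0 < g x → G (x - h) ≤ G x) :
    Integrable (fun x => G x * (g (x + h) - g x)) ∧ ∫ x, G x * (g (x + h) - g x) ≤ 0 := by
  have hb : ∀ {u : ℝ → ℝ}, Integrable u → Integrable fun x => G x * u x := fun hu =>
    hu.bdd_mul (c := 1) hG.aestronglyMeasurable (ae_of_all _ hG1)
  have hb' : ∀ {u : ℝ → ℝ}, Integrable u → Integrable fun x => G (x - h) * u x := fun hu =>
    hu.bdd_mul (c := 1) (hG.comp (measurable_id.sub_const h)).aestronglyMeasurable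
      (ae_of_all _ fun x => hG1 _)
  have hgh := hg.comp_add_right h
  have e : ∀ x, G x * (g (x + h) - g x) = G x * g (x + h) - G x * g x := fun x => by ring
  simp_rw [e]
  refine ⟨(hb hgh).sub (hb hg), ?_⟩
  rw [integral_sub (hb hgh) (hb hg), ← integral_sub_right_eq_self (fun x => G x * g (x + h)) h]
  simp only [sub_add_cancel]
  rw [sub_nonpos]
  refine integral_mono (hb' hg) (hb hg) fun x => ?_
  rcases (hg0 x).eq_or_lt with h0 | h0
  · simp [← h0]
  · exact mul_le_mul_of_nonneg_right (hmono x h0) h0.le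

theorem tendsto_setIntegral_truncAbs_slope {u : ℝ → ℝ} (hu : LipschitzWith L u) {K : ℝ}
    (hK : 0 ≤ K) (a b : ℝ) :
    Tendsto (fun h => ∫ x in Icc a b, truncAbs K (h⁻¹ * (u (x + h) - u x))) (𝓝[>] 0)
      (𝓝 (∫ x in Icc a b, truncAbs K (deriv u x))) := by
  refine tendsto_integral_filter_of_dominated_convergence (fun _ => (L : ℝ)) ?_ ?_ ?_ ?_
  · refine Eventually.of_forall fun h => Continuous.aestronglyMeasurable ?_
    have := hu.continuous
    exact (continuous_truncAbs K).comp (by fun_prop)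
  · filter_upwards [self_mem_nhdsWithin] with h hh
    refine ae_of_all _ fun x => ?_
    have hh' : 0 < h := hh
    rw [Real.norm_eq_abs, abs_of_nonneg (truncAbs_nonneg _ _)]
    refine (truncAbs_le_abs hK _).trans ?_
    rw [abs_mul, abs_inv, abs_of_pos hh', inv_mul_le_iff₀ hh']
    have := hu.abs_sub_le (x + h) x
    rwa [add_sub_cancel_left, abs_of_pos hh', mul_comm] at this
  · exact integrableOn_const (by simp)
  · filter_upwards [ae_restrict_of_ae hu.ae_differentiableAt_real] with x hx
    have := (hasDerivAt_iff_tendsto_slope_zero.1 hx.hasDerivAt).mono_left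
      (nhdsWithin_mono 0 (fun h (hh : 0 < h) => hh.ne'))
    exact ((continuous_truncAbs K).tendsto _).comp this

theorem integrableOn_truncAbs_deriv {u : ℝ → ℝ} (hu : LipschitzWith L u) {K : ℝ} (hK : 0 ≤ K)
    {S : Set ℝ} (hS : volume S ≠ ⊤) : IntegrableOn (fun x => truncAbs K (deriv u x)) S := by
  refine Integrable.mono' (g := fun _ => (L : ℝ)) (integrableOn_const hS)
    ((continuous_truncAbs K).measurable.comp (measurable_deriv u)).aestronglyMeasurable
    (ae_of_all _ fun x => ?_)
  rw [Real.norm_eq_abs, abs_of_nonneg (truncAbs_nonneg _ _)]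
  exact (truncAbs_le_abs hK _).trans (norm_deriv_le_of_lipschitz hu)

theorem ofReal_truncAbs (K s : ℝ) : ENNReal.ofReal (truncAbs K s) = ENNReal.ofReal (|s| - K) := by
  rw [truncAbs, ENNReal.ofReal_max, ENNReal.ofReal_zero, max_eq_left zero_le]

theorem deriv_eq_of_le_of_eq {u v : ℝ → ℝ} {x : ℝ} (hu : DifferentiableAt ℝ u x)
    (hv : DifferentiableAt ℝ v x) (hle : ∀ y, u y ≤ v y) (heq : u x = v x) :
    deriv u x = deriv v x := by
  have hmin : IsLocalMin (fun y => v y - u y) x :=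
    Eventually.of_forall fun y => by simp only [heq, sub_self]; linarith [hle y]
  have := hmin.deriv_eq_zero
  rw [deriv_fun_sub hv hu] at this
  linarith

/-- Difference quotients of `M` are compared with those of `min M (f + δ)`. By the subgradient
inequality the error is the integral of a subgradient of the slope of `M` against the slope of `g =
(M - f - δ)₊`; it is nonpositive because `M` is midpoint convex at small scales where `g > 0`. The
level `δ` makes one scale `h` serve all these points. -/
theorem setLIntegral_truncAbs_deriv_le (hf : LipschitzWith L f) (hM : LipschitzWith L M)
    (hcomp : ∀ a b c s, (∀ x ∈ Icc a b, f x ≤ c + s * x) → M a ≤ c + s * a → M b ≤ c + s * b →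
      ∀ x ∈ Icc a b, M x ≤ c + s * x) {K : ℝ} (hK : 0 ≤ K) {δ : ℝ} (hδ : 0 < δ)
    {R : ℝ} (hR : ∀ x, R < |x| → M x - f x < δ) :
    ∫⁻ x in {x | δ < M x - f x}, ENNReal.ofReal (truncAbs K (deriv M x)) ≤
      ∫⁻ x in {x | δ < M x - f x}, ENNReal.ofReal (truncAbs K (deriv f x)) := by
  set E := {x | δ < M x - f x} with hE
  set g : ℝ → ℝ := fun x => max (M x - f x - δ) 0 with hg
  -- Not a derivative: `f'` is the function `min M (f + δ)`.
  set f' : ℝ → ℝ := fun x => M x - g x with hf'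
  have hfc := hf.continuous
  have hMc := hM.continuous
  have hgL : LipschitzWith (L + L) g :=
    ((hM.sub hf).sub (LipschitzWith.const δ)).max_const 0 |>.weaken (by simp)
  have hf'L : LipschitzWith (L + (L + L)) f' := hM.sub hgL
  have hM' : LipschitzWith (L + (L + L)) M := hM.weaken (by simp)
  have hg0 : ∀ x, 0 ≤ g x := fun x => le_max_right _ _
  have hgsupp : ∀ x, R < |x| → g x = 0 := fun x hx => max_eq_right (by linarith [hR x hx])
  have hgint : Integrable g := by
    refine hgL.continuous.integrable_of_hasCompactSupport
      (HasCompactSupport.intro (isCompact_Icc (a := -R) (b := R)) fun x hx => hgsupp x ?_)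
    by_contra! h
    exact hx (abs_le.1 h)
  -- The margin 1 ensures that, for steps `h < 1`, both `g x` and `g (x + h)` vanish for `x` outside
  -- `I`.
  set I := Icc (-R - 1) (R + 1) with hI
  have hEI : E ⊆ I := by
    intro x hx
    have h1 : |x| ≤ R := by
      by_contra! h
      exact absurd (hR x h) (not_lt.2 (le_of_lt hx))
    have := abs_le.1 h1
    exact ⟨by linarith, by linarith⟩
  have hEm : MeasurableSet E := measurableSet_lt measurable_const (hMc.sub hfc).measurable
  have hstep : ∀ᶠ h in 𝓝[>] (0 : ℝ), ∫ x in I, truncAbs K (h⁻¹ * (M (x + h) - M x)) ≤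
      ∫ x in I, truncAbs K (h⁻¹ * (f' (x + h) - f' x)) := by
    have hh2 : 0 < δ / (6 * L + 1) := by positivity
    filter_upwards [self_mem_nhdsWithin, Ioo_mem_nhdsGT hh2, Ioo_mem_nhdsGT one_pos] with h hh0 h1 h2
    have hh : 0 < h := hh0
    have hLh : 6 * L * h ≤ δ := by
      have := h1.2.le
      rw [le_div_iff₀ (by positivity)] at this
      linarith
    have hGm : Measurable fun x => truncSign K (h⁻¹ * (M (x + h) - M x)) :=
      (truncSign_mono hK).measurable.comp (by fun_prop)
    obtain ⟨hint, hle⟩ := integral_mul_shift_sub_nonpos (h := h) hGm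
      (fun x => abs_truncSign_le K _) hgint hg0 (fun x hx => by
        refine truncSign_mono hK ?_
        have hx' : δ < M x - f x := by
          by_contra! hcon
          rw [hg] at hx
          simp only [lt_max_iff, lt_irrefl, or_false] at hx
          linarith
        have := midpoint_le_of_detached hf hM hcomp hh (hLh.trans_lt hx')
        rw [sub_add_cancel]
        gcongr ?_ * ?_
        linarith)
    have hcont : ∀ {u : ℝ → ℝ}, Continuous u →
        IntegrableOn (fun x => truncAbs K (h⁻¹ * (u (x + h) - u x))) I := fun hu =>
      ((continuous_truncAbs K).comp (by fun_prop)).continuousOn.integrableOn_compact isCompact_Icc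
    have hsupp : ∫ x in I, truncSign K (h⁻¹ * (M (x + h) - M x)) * (g (x + h) - g x) =
        ∫ x, truncSign K (h⁻¹ * (M (x + h) - M x)) * (g (x + h) - g x) := by
      refine setIntegral_eq_integral_of_forall_compl_eq_zero fun x hx => ?_
      have hx' : R + 1 < |x| := by
        by_contra! hcon
        have := abs_le.1 hcon
        exact hx ⟨by linarith, this.2⟩
      have h3 : R < |x + h| := by
        have := abs_sub_abs_le_abs_sub x (-h)
        rw [sub_neg_eq_add, abs_neg, abs_of_pos hh] at this
        linarith [h2.2]
      rw [hgsupp x (by linarith), hgsupp _ h3]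
      simp
    have hptw : ∀ x, truncAbs K (h⁻¹ * (M (x + h) - M x)) ≤
        truncAbs K (h⁻¹ * (f' (x + h) - f' x)) +
          h⁻¹ * (truncSign K (h⁻¹ * (M (x + h) - M x)) * (g (x + h) - g x)) := by
      intro x
      refine (truncAbs_le_add hK _ (h⁻¹ * (f' (x + h) - f' x))).trans (le_of_eq ?_)
      simp only [hf']
      ring
    have := setIntegral_mono (μ := volume) (s := I) (hcont hMc)
      ((hcont hf'L.continuous).add (hint.integrableOn.const_mul h⁻¹)) hptw
    simp only [Pi.add_apply] at this
    rw [integral_add (hcont hf'L.continuous) (hint.integrableOn.const_mul h⁻¹),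
      integral_const_mul, hsupp] at this
    have h4 := mul_nonpos_of_nonneg_of_nonpos (inv_nonneg.2 hh.le) hle
    linarith
  have hlim := le_of_tendsto_of_tendsto (tendsto_setIntegral_truncAbs_slope hM hK _ _)
    (tendsto_setIntegral_truncAbs_slope hf'L hK _ _) hstep
  -- On `E` the function `f'` is a translate `f + δ`; off `E` it touches `M` from below, so the two
  -- derivatives agree where both exist.
  have hae : ∀ᵐ x, truncAbs K (deriv M x) - truncAbs K (deriv f' x) =
      E.indicator (fun x => truncAbs K (deriv M x) - truncAbs K (deriv f x)) x := by
    filter_upwards [hM.ae_differentiableAt_real, hf.ae_differentiableAt_real,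
      hf'L.ae_differentiableAt_real] with x hMx hfx hf'x
    by_cases hx : x ∈ E
    · rw [indicator_of_mem hx]
      have hEo : IsOpen E := isOpen_lt continuous_const (hMc.sub hfc)
      have : f' =ᶠ[𝓝 x] fun y => f y + δ := by
        filter_upwards [hEo.mem_nhds hx] with y hy
        have hy' : δ < M y - f y := hy
        simp only [hf', hg]
        rw [max_eq_left (by linarith)]
        ring
      rw [this.deriv_eq, deriv_add_const]
    · rw [indicator_of_notMem hx]
      have hx' : M x - f x ≤ δ := not_lt.1 hx
      rw [deriv_eq_of_le_of_eq hf'x hMx (fun y => sub_le_self _ (hg0 y)), sub_self]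
      simp only [hf', hg]
      rw [max_eq_right (by linarith), sub_zero]
  have hIfin : volume I ≠ ⊤ := by simp [hI]
  have hEfin : volume E ≠ ⊤ := ne_top_of_le_ne_top hIfin (measure_mono hEI)
  have hsub : ∫ x in E, (truncAbs K (deriv M x) - truncAbs K (deriv f x)) ≤ 0 := by
    have h1 : ∫ x in I, (truncAbs K (deriv M x) - truncAbs K (deriv f' x)) ≤ 0 := by
      rw [integral_sub (integrableOn_truncAbs_deriv hM hK hIfin)
        (integrableOn_truncAbs_deriv hf'L hK hIfin)]
      linarith
    rw [setIntegral_congr_ae measurableSet_Icc (hae.mono fun x hx _ => hx),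
      setIntegral_indicator hEm, inter_eq_self_of_subset_right hEI] at h1
    exact h1
  have hiM := integrableOn_truncAbs_deriv hM hK hEfin
  have hif := integrableOn_truncAbs_deriv hf hK hEfin
  rw [integral_sub hiM hif, sub_nonpos] at hsub
  rw [← ofReal_integral_eq_lintegral_ofReal hiM (ae_of_all _ fun _ => truncAbs_nonneg _ _),
    ← ofReal_integral_eq_lintegral_ofReal hif (ae_of_all _ fun _ => truncAbs_nonneg _ _)]
  exact ENNReal.ofReal_le_ofReal hsub

/-- If `M ≥ f` obeys the comparison principle with respect to affine majorants of `f` and `M - f`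
vanishes at infinity, then the derivative of `M` is majorized by that of `f`. -/
theorem lintegral_truncAbs_deriv_le (hf : LipschitzWith L f) (hM : LipschitzWith L M)
    (hfM : ∀ x, f x ≤ M x)
    (hcomp : ∀ a b c s, (∀ x ∈ Icc a b, f x ≤ c + s * x) → M a ≤ c + s * a → M b ≤ c + s * b →
      ∀ x ∈ Icc a b, M x ≤ c + s * x) (hdecay : ∀ δ > 0, ∃ R, ∀ x, R < |x| → M x - f x < δ)
    {K : ℝ} (hK : 0 ≤ K) :
    ∫⁻ x, ENNReal.ofReal (truncAbs K (deriv M x)) ≤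
      ∫⁻ x, ENNReal.ofReal (truncAbs K (deriv f x)) := by
  have hcont : Continuous fun x => M x - f x := hM.continuous.sub hf.continuous
  set E := {x | 0 < M x - f x} with hE
  have hEm : MeasurableSet E := measurableSet_lt measurable_const hcont.measurable
  -- The detached set is exhausted by the levels `1 / (n + 1)`; on the contact set `M - f` is
  -- minimal, so the derivatives agree almost everywhere.
  have hEU : E = ⋃ n : ℕ, {x | 1 / ((n : ℝ) + 1) < M x - f x} := by
    ext x
    simp only [hE, mem_ofPred_eq, mem_iUnion]
    exact ⟨fun h => exists_nat_one_div_lt h, fun ⟨n, hn⟩ => lt_trans (by positivity) hn⟩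
  have hdir : Directed (· ⊆ ·) fun n : ℕ => {x | 1 / ((n : ℝ) + 1) < M x - f x} :=
    directed_of_isDirected_le fun m n hmn x (hx : 1 / ((m : ℝ) + 1) < M x - f x) =>
      show 1 / ((n : ℝ) + 1) < M x - f x from (Nat.one_div_le_one_div hmn).trans_lt hx
  rw [← lintegral_add_compl _ hEm, ← lintegral_add_compl (fun x => ENNReal.ofReal
    (truncAbs K (deriv f x))) hEm]
  refine add_le_add ?_ (le_of_eq ?_)
  · rw [hEU, setLIntegral_iUnion_of_directed _ hdir, setLIntegral_iUnion_of_directed _ hdir]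
    refine iSup_mono fun n => ?_
    obtain ⟨R, hR⟩ := hdecay (1 / ((n : ℝ) + 1)) (by positivity)
    exact setLIntegral_truncAbs_deriv_le hf hM hcomp hK (by positivity) hR
  · refine setLIntegral_congr_fun_ae hEm.compl ?_
    filter_upwards [hM.ae_differentiableAt_real, hf.ae_differentiableAt_real] with x hMx hfx hx
    have hx' : M x - f x ≤ 0 := not_lt.1 hx
    rw [deriv_eq_of_le_of_eq hfx hMx hfM (by linarith [hfM x])]

end

/-! ### Averaging and truncated integrals. -/

theorem ofReal_truncAbs_eq_enorm_sub (K : ℝ≥0) (s : ℝ) :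
    ENNReal.ofReal (truncAbs K s) = ‖s‖ₑ - K := by
  rw [ofReal_truncAbs, ENNReal.ofReal_sub _ K.coe_nonneg, Real.enorm_eq_ofReal_abs, ENNReal.ofReal_coe_nnreal]

/-- The domination must hold everywhere, since `F` will be integrated against measures `ν` that may
charge Lebesgue-null sets. -/
theorem AEMeasurable.exists_measurable_ge_ae_eq {F : ℝ → ℝ≥0∞} (hF : AEMeasurable F) :
    ∃ G, Measurable G ∧ F ≤ G ∧ F =ᵐ[volume] G := by
  set N := toMeasurable volume {x | F x ≠ hF.mk F x} with hN
  have hN0 : volume N = 0 := by rw [hN, measure_toMeasurable]; exact hF.ae_eq_mk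
  have hNm : MeasurableSet N := measurableSet_toMeasurable _ _
  have hoff : ∀ x ∉ N, F x = hF.mk F x := fun x hx => by
    by_contra h
    exact hx (subset_toMeasurable _ _ h)
  classical
  refine ⟨N.piecewise (fun _ => ⊤) (hF.mk F), measurable_const.piecewise hNm hF.measurable_mk,
    fun x => ?_, ?_⟩
  · by_cases hx : x ∈ N
    · simp [hx]
    · simp [hx, hoff x hx]
  · filter_upwards [measure_eq_zero_iff_ae_notMem.1 hN0] with x hx
    simp [hx, hoff x hx]

/-- Jensen's inequality for `(· - K)₊`, followed by Tonelli and translation invariance. -/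
theorem lintegral_average_tsub_le (ν : Measure ℝ) [IsProbabilityMeasure ν] {F : ℝ → ℝ≥0∞}
    (hF : AEMeasurable F) (K : ℝ≥0∞) :
    ∫⁻ x, (∫⁻ s, F (x + s) ∂ν - K) ≤ ∫⁻ x, (F x - K) := by
  obtain ⟨G, hG, hFG, hae⟩ := hF.exists_measurable_ge_ae_eq
  have h1 : ∫⁻ x, (F x - K) = ∫⁻ x, (G x - K) :=
    lintegral_congr_ae (hae.mono fun x hx => by simp only [hx])
  rw [h1]
  have hGK : Measurable fun x => G x - K := hG.sub measurable_const
  calc ∫⁻ x, (∫⁻ s, F (x + s) ∂ν - K)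
      ≤ ∫⁻ x, ∫⁻ s, (G (x + s) - K) ∂ν := by
        refine lintegral_mono fun x => ?_
        rw [tsub_le_iff_right]
        calc ∫⁻ s, F (x + s) ∂ν ≤ ∫⁻ s, ((G (x + s) - K) + K) ∂ν :=
              lintegral_mono fun s => (hFG _).trans le_tsub_add
          _ = _ := by
              rw [lintegral_add_right _ measurable_const]
              simp
    _ = ∫⁻ s, (∫⁻ x, (G (x + s) - K)) ∂ν :=
        lintegral_lintegral_swap (hGK.comp (measurable_fst.add measurable_snd)).aemeasurable
    _ = ∫⁻ x, (G x - K) := by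
        simp_rw [lintegral_add_right_eq_self (fun x => G x - K)]
        simp

theorem lintegral_poissonAverage_tsub_le {F : ℝ → ℝ≥0∞} (hF : AEMeasurable F) {t : ℝ} (ht : 0 < t)
    (K : ℝ≥0∞) : ∫⁻ x, (poissonAverage F x t - K) ≤ ∫⁻ x, (F x - K) := by
  have hPm := measurable_ofReal_poissonKernel1D 0 ht
  have : IsProbabilityMeasure (volume.withDensity
      fun s => ENNReal.ofReal (poissonKernel1D (0 - s) t)) :=
    ⟨by rw [withDensity_apply _ MeasurableSet.univ, setLIntegral_univ,
      lintegral_poissonKernel1D 0 ht]⟩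
  refine le_trans (le_of_eq (lintegral_congr fun x => ?_)) (lintegral_average_tsub_le
    (volume.withDensity fun s => ENNReal.ofReal (poissonKernel1D (0 - s) t)) hF K)
  rw [lintegral_withDensity_eq_lintegral_mul_non_measurable _ hPm
    (ae_of_all _ fun _ => ENNReal.ofReal_lt_top)]
  unfold poissonAverage
  rw [← lintegral_add_left_eq_self _ x]
  simp

/-- The difference quotient is dominated by the average of `‖v‖` over an interval of length `h`,
that is, by averaging against the uniform measure on `(0, h]`. -/
theorem lintegral_slope_tsub_le {E E' : Type*} [NormedAddCommGroup E] [NormedAddCommGroup E']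
    [NormedSpace ℝ E] {u : ℝ → E} {v : ℝ → E'}
    (hv : AEStronglyMeasurable v volume) {h : ℝ} (hh : 0 < h)
    (huv : ∀ᵐ x, ‖u (x + h) - u x‖ₑ ≤ ∫⁻ s in Ioc x (x + h), ‖v s‖ₑ) (K : ℝ≥0∞) :
    ∫⁻ x, (‖h⁻¹ • (u (x + h) - u x)‖ₑ - K) ≤ ∫⁻ x, (‖v x‖ₑ - K) := by
  have hne : ENNReal.ofReal h ≠ 0 := by simpa using hh
  set ν : Measure ℝ := (ENNReal.ofReal h)⁻¹ • volume.restrict (Ioc 0 h) with hν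
  have : IsProbabilityMeasure ν := ⟨by
    simp [hν, ENNReal.inv_mul_cancel hne ENNReal.ofReal_ne_top]⟩
  refine (lintegral_mono_ae (huv.mono fun x hx => ?_)).trans
    (lintegral_average_tsub_le ν hv.enorm K)
  refine tsub_le_tsub_right ?_ K
  rw [enorm_smul, hν, lintegral_smul_measure, smul_eq_mul, Real.enorm_eq_ofReal (by positivity),
    ENNReal.ofReal_inv_of_pos hh]
  gcongr
  refine hx.trans (le_of_eq ?_)
  rw [← lintegral_indicator measurableSet_Ioc, ← lintegral_indicator measurableSet_Ioc,
    ← lintegral_add_left_eq_self _ x]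
  refine lintegral_congr fun s => ?_
  by_cases hs : s ∈ Ioc 0 h
  · rw [indicator_of_mem hs, indicator_of_mem (by exact ⟨by linarith [hs.1], by linarith [hs.2]⟩)]
  · rw [indicator_of_notMem hs, indicator_of_notMem]
    exact fun h' => hs ⟨by linarith [h'.1], by linarith [h'.2]⟩

/-- Fatou's lemma along the steps `1 / (n + 1)`. -/
theorem lintegral_deriv_tsub_le_of_slope {u : ℝ → ℝ} (hu : Continuous u)
    (hd : ∀ᵐ x, DifferentiableAt ℝ u x) {K E : ℝ≥0∞}
    (h : ∀ h > 0, ∫⁻ x, (‖h⁻¹ • (u (x + h) - u x)‖ₑ - K) ≤ E) :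
    ∫⁻ x, (‖deriv u x‖ₑ - K) ≤ E := by
  set η : ℕ → ℝ := fun n => 1 / ((n : ℝ) + 1) with hη
  have hη0 : ∀ n, 0 < η n := fun n => by positivity
  have hlim : Tendsto η atTop (𝓝[≠] 0) :=
    tendsto_nhdsWithin_iff.2 ⟨tendsto_one_div_add_atTop_nhds_zero_nat,
      Eventually.of_forall fun n => (hη0 n).ne'⟩
  calc ∫⁻ x, (‖deriv u x‖ₑ - K)
      = ∫⁻ x, liminf (fun n => ‖(η n)⁻¹ • (u (x + η n) - u x)‖ₑ - K) atTop := by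
        refine lintegral_congr_ae (hd.mono fun x hx => ?_)
        have h1 := (hasDerivAt_iff_tendsto_slope_zero.1 hx.hasDerivAt).comp hlim
        have h2 : Tendsto (fun n => ‖(η n)⁻¹ • (u (x + η n) - u x)‖ₑ - K) atTop
            (𝓝 (‖deriv u x‖ₑ - K)) :=
          ENNReal.Tendsto.sub h1.enorm tendsto_const_nhds (Or.inl enorm_ne_top)
        exact h2.liminf_eq.symm
    _ ≤ liminf (fun n => ∫⁻ x, (‖(η n)⁻¹ • (u (x + η n) - u x)‖ₑ - K)) atTop := by
        refine lintegral_liminf_le fun n => Measurable.sub ?_ measurable_const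
        exact (Continuous.measurable (by fun_prop)).enorm
    _ ≤ E := by
        refine liminf_le_of_frequently_le' (Eventually.frequently (Eventually.of_forall fun n => ?_))
        exact h _ (hη0 n)

section
variable {f : ℝ → ℝ} {α ε : ℝ}

theorem enorm_poissonIntegral_sub_le (hf : Integrable f) (hε : 0 < ε) (x h : ℝ) :
    ‖h⁻¹ • (poissonIntegral f (x + h) ε - poissonIntegral f x ε)‖ₑ ≤
      poissonAverage (fun z => ‖h⁻¹ • (f (z + h) - f z)‖ₑ) x ε := by
  have e : poissonIntegral f (x + h) ε = ∫ z, poissonKernel1D (x - z) ε * f (z + h) := by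
    unfold poissonIntegral
    rw [← integral_add_right_eq_self _ h]
    simp
  have e2 : h⁻¹ • (poissonIntegral f (x + h) ε - poissonIntegral f x ε) =
      ∫ z, poissonKernel1D (x - z) ε * (h⁻¹ • (f (z + h) - f z)) := by
    rw [e, poissonIntegral, ← integral_sub (integrable_poissonKernel1D_mul (hf.comp_add_right h) x hε)
      (integrable_poissonKernel1D_mul hf x hε), ← integral_smul]
    refine integral_congr_ae (ae_of_all _ fun z => ?_)
    simp only [smul_eq_mul]
    ring
  rw [e2]
  refine (enorm_integral_le_lintegral_enorm _).trans (le_of_eq (lintegral_congr fun z => ?_))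
  rw [enorm_mul, Real.enorm_eq_ofReal (poissonKernel1D_nonneg _ hε.le)]

/-- Assuming a bound on difference quotients rather than on a derivative covers functions with
jumps, as needed for bounded variation. -/
theorem lintegral_deriv_poissonIntegral_tsub_le (hf : Integrable f) (hε : 0 < ε) {K E : ℝ≥0∞}
    (h : ∀ h > 0, ∫⁻ x, (‖h⁻¹ • (f (x + h) - f x)‖ₑ - K) ≤ E) :
    ∫⁻ x, (‖deriv (fun y => poissonIntegral f y ε) x‖ₑ - K) ≤ E := by
  obtain ⟨C, hC, -⟩ := exists_lipschitzWith_poissonIntegral_shiftedConeSup (α := 0) hf hε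
  refine lintegral_deriv_tsub_le_of_slope hC.continuous hC.ae_differentiableAt_real fun r hr => ?_
  refine (lintegral_mono fun x =>
    tsub_le_tsub_right (enorm_poissonIntegral_sub_le hf hε x r) K).trans
    ((lintegral_poissonAverage_tsub_le ?_ hε K).trans (h r hr))
  exact (((hf.comp_add_right r).sub hf).smul r⁻¹).aestronglyMeasurable.enorm

theorem lintegral_deriv_shiftedConeSup_tsub_le (hf : Integrable f) (hf0 : ∀ z, 0 ≤ f z) {A : ℝ}
    (hA : ∀ z, A < |z| → f z = 0) (hα : 0 ≤ α) (hε : 0 < ε) {K : ℝ≥0} {E : ℝ≥0∞}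
    (h : ∀ h > 0, ∫⁻ x, (‖h⁻¹ • (f (x + h) - f x)‖ₑ - K) ≤ E) :
    ∫⁻ x, (‖deriv (shiftedConeSup α ε f) x‖ₑ - K) ≤ E := by
  refine le_trans ?_ (lintegral_deriv_poissonIntegral_tsub_le hf hε h)
  obtain ⟨C, hC1, hC2⟩ := exists_lipschitzWith_poissonIntegral_shiftedConeSup (α := α) hf hε
  simp_rw [← ofReal_truncAbs_eq_enorm_sub]
  refine lintegral_truncAbs_deriv_le hC1 hC2 (poissonIntegral_le_shiftedConeSup_self hf hε)
    (fun a b c s h1 h2 h3 x hx => shiftedConeSup_le_affine hf hε h1 h2 h3 hx) (fun δ hδ => ?_) K.2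
  obtain ⟨R, -, hR⟩ := exists_shiftedConeSup_lt hf hf0 hA hα hε hδ
  exact ⟨R, fun x hx => by linarith [hR x hx, poissonIntegral_nonneg hf0 x hε.le]⟩

theorem shiftedConeSup_nonneg (hf : Integrable f) (hf0 : ∀ z, 0 ≤ f z) (hε : 0 < ε) (x : ℝ) :
    0 ≤ shiftedConeSup α ε f x :=
  (poissonIntegral_nonneg hf0 x hε.le).trans (poissonIntegral_le_shiftedConeSup_self hf hε x)

/-- The shifted suprema never exceed the full one. Conversely, a nearly optimal point `(y, t)` of
the cone stays nearly optimal for some `f N` by monotone convergence, and it can be moved slightly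
into the shifted cones. -/
theorem tendsto_shiftedConeSup (hα : 0 ≤ α) {F : ℝ → ℝ≥0∞} {f : ℕ → ℝ → ℝ}
    (hfm : ∀ n, Measurable (f n)) (hf : ∀ n, Integrable (f n)) (hf0 : ∀ n z, 0 ≤ f n z)
    (hmono : Monotone f) (hsup : ∀ z, ⨆ n, ENNReal.ofReal (f n z) = F z) {ε : ℕ → ℝ}
    (hε : ∀ n, 0 < ε n) (hε0 : Tendsto ε atTop (𝓝 0)) {x : ℝ} (hfin : coneSup α F x < ⊤) :
    Tendsto (fun n => shiftedConeSup α (ε n) (f n) x) atTop (𝓝 (coneSup α F x).toReal) := by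
  have hle : ∀ n, ENNReal.ofReal (shiftedConeSup α (ε n) (f n) x) ≤ coneSup α F x := fun n =>
    (ofReal_shiftedConeSup_le_coneSup (hf n) (hf0 n) hα (hε n) x).trans
      (coneSup_mono_ae (ae_of_all _ fun z => (hsup z) ▸ le_iSup (fun n => ENNReal.ofReal (f n z)) n) x)
  have hlim : Tendsto (fun n => ENNReal.ofReal (shiftedConeSup α (ε n) (f n) x)) atTop
      (𝓝 (coneSup α F x)) := by
    refine tendsto_order.2 ⟨fun c hc => ?_, fun c hc => Eventually.of_forall fun n =>
      (hle n).trans_lt hc⟩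
    obtain ⟨t, ht, y, hy, hlt⟩ := lt_coneSup_iff.1 hc
    have hPF : poissonAverage F y t =
        ⨆ n, poissonAverage (fun z => ENNReal.ofReal (f n z)) y t := by
      unfold poissonAverage
      rw [← lintegral_iSup]
      · refine lintegral_congr fun z => ?_
        rw [← hsup z, ENNReal.mul_iSup]
      · exact fun n => (measurable_ofReal_poissonKernel1D y ht).mul (hfm n).ennreal_ofReal
      · intro m n hmn z
        exact mul_le_mul_right (ENNReal.ofReal_le_ofReal (hmono hmn z)) _
    rw [hPF, lt_iSup_iff] at hlt
    obtain ⟨N, hN⟩ := hlt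
    rw [poissonAverage_ofReal (hf N) (hf0 N) y ht] at hN
    obtain ⟨C, hC, -⟩ := exists_lipschitzWith_poissonIntegral_shiftedConeSup (α := α) (hf N) ht
    -- The offset `y - x` is scaled by `(t - ε n) / t`, which places the point at unchanged height
    -- `t` in the cone with vertex at height `ε n`.
    have hyn : Tendsto (fun n => x + (y - x) * ((t - ε n) / t)) atTop (𝓝 y) := by
      have h1 : Tendsto (fun n => x + (y - x) * ((t - ε n) / t)) atTop
          (𝓝 (x + (y - x) * ((t - 0) / t))) :=
        (((tendsto_const_nhds.sub hε0).div_const t).const_mul (y - x)).const_add x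
      rwa [sub_zero, div_self ht.ne', mul_one, add_sub_cancel] at h1
    have hev := (ENNReal.tendsto_ofReal ((hC.continuous.tendsto y).comp hyn)).eventually
      (lt_mem_nhds hN)
    filter_upwards [hev, eventually_ge_atTop N, hε0.eventually (gt_mem_nhds ht)] with n h1 h2 h3
    refine h1.trans_le (ENNReal.ofReal_le_ofReal ?_)
    have h4 : 0 < t - ε n := by linarith
    have h5 : poissonIntegral (f N) (x + (y - x) * ((t - ε n) / t)) t ≤
        poissonIntegral (f n) (x + (y - x) * ((t - ε n) / t)) t :=
      integral_mono (integrable_poissonKernel1D_mul (hf N) _ ht)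
        (integrable_poissonKernel1D_mul (hf n) _ ht) fun z =>
          mul_le_mul_of_nonneg_left (hmono h2 z) (poissonKernel1D_nonneg _ ht.le)
    refine h5.trans ?_
    have h6 := poissonIntegral_le_shiftedConeSup (α := α) (hf n) (hε n) x
      (s := (y - x) * ((t - ε n) / t)) h4.le ?_
    · rwa [sub_add_cancel] at h6
    · rw [abs_mul, abs_of_pos (by positivity : 0 < (t - ε n) / t)]
      calc |y - x| * ((t - ε n) / t) ≤ α * t * ((t - ε n) / t) := by gcongr
        _ = _ := by field_simp
  have := (ENNReal.tendsto_toReal hfin.ne).comp hlim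
  refine this.congr fun n => ?_
  simp only [Function.comp]
  exact ENNReal.toReal_ofReal (shiftedConeSup_nonneg (hf n) (hf0 n) (hε n) x)

end

/-! ### Variation, absolute continuity and passage to the limit. -/

theorem AbsolutelyContinuousOnInterval.edist_le_lintegral_deriv {u : ℝ → ℝ} {a b : ℝ}
    (hu : AbsolutelyContinuousOnInterval u a b) :
    edist (u a) (u b) ≤ ∫⁻ x in uIoc a b, ‖deriv u x‖ₑ := by
  rw [edist_comm, edist_eq_enorm_sub, ← hu.integral_deriv_eq_sub,
    enorm_eq_iff_norm_eq.2 (intervalIntegral.norm_intervalIntegral_eq (deriv u) a b volume)]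
  exact enorm_integral_le_lintegral_enorm _

theorem LipschitzWith.edist_le_lintegral_deriv {L : ℝ≥0} {u : ℝ → ℝ} (hu : LipschitzWith L u)
    (a b : ℝ) : edist (u a) (u b) ≤ ∫⁻ x in uIoc a b, ‖deriv u x‖ₑ :=
  (hu.lipschitzOnWith (s := uIcc a b)).absolutelyContinuousOnInterval.edist_le_lintegral_deriv

/-- Splitting `|u'| ≤ (|u'| - K)₊ + K` separates a part independent of the intervals from one
proportional to their total length. `K = 0` gives the variation bound, large `K` absolute
continuity. -/
theorem LipschitzWith.sum_edist_le {L : ℝ≥0} {u : ℝ → ℝ} (hu : LipschitzWith L u) {ι : Type*}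
    (s : Finset ι) (a b : ι → ℝ) (hd : (s : Set ι).PairwiseDisjoint fun i => uIoc (a i) (b i))
    (K : ℝ≥0∞) :
    ∑ i ∈ s, edist (u (a i)) (u (b i)) ≤
      (∫⁻ x, (‖deriv u x‖ₑ - K)) + K * ∑ i ∈ s, edist (a i) (b i) := by
  calc ∑ i ∈ s, edist (u (a i)) (u (b i))
      ≤ ∑ i ∈ s, ∫⁻ x in uIoc (a i) (b i), ((‖deriv u x‖ₑ - K) + K) :=
        Finset.sum_le_sum fun i _ => (hu.edist_le_lintegral_deriv _ _).trans
          (lintegral_mono fun x => le_tsub_add)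
    _ = ∑ i ∈ s, ((∫⁻ x in uIoc (a i) (b i), (‖deriv u x‖ₑ - K)) + K * edist (a i) (b i)) := by
        refine Finset.sum_congr rfl fun i _ => ?_
        rw [lintegral_add_right _ measurable_const, setLIntegral_const, edist_dist, Real.dist_eq,
          Real.volume_uIoc, abs_sub_comm]
    _ = (∫⁻ x in ⋃ i ∈ s, uIoc (a i) (b i), (‖deriv u x‖ₑ - K)) + K * ∑ i ∈ s, edist (a i) (b i) := by
        rw [Finset.sum_add_distrib, Finset.mul_sum,
          lintegral_biUnion_finset hd fun i _ => measurableSet_uIoc]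
    _ ≤ _ := by
        gcongr
        exact Measure.restrict_le_self

theorem LipschitzWith.eVariationOn_le_lintegral_deriv {L : ℝ≥0} {u : ℝ → ℝ}
    (hu : LipschitzWith L u) : eVariationOn u univ ≤ ∫⁻ x, ‖deriv u x‖ₑ := by
  refine iSup_le fun p => ?_
  obtain ⟨n, w, hw, -⟩ := p
  have hd : ((Finset.range n : Finset ℕ) : Set ℕ).PairwiseDisjoint
      fun i => uIoc (w (i + 1)) (w i) := by
    intro i _ j _ hij
    have h1 : ∀ i, uIoc (w (i + 1)) (w i) = Ioc (w i) (w (i + 1)) := fun i => by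
      rw [uIoc_comm, uIoc_of_le (hw (Nat.le_succ i))]
    simp only [h1, Function.onFun]
    exact hw.pairwise_disjoint_on_Ioc_succ hij
  simpa using hu.sum_edist_le (Finset.range n) (fun i => w (i + 1)) w hd 0

section
variable {M : ℝ → ℝ} {Mn : ℕ → ℝ → ℝ} {L : ℕ → ℝ≥0} {η : ℝ≥0 → ℝ≥0∞}

theorem sum_edist_le_of_tendsto (hL : ∀ n, LipschitzWith (L n) (Mn n))
    (hlim : ∀ x, Tendsto (fun n => Mn n x) atTop (𝓝 (M x)))
    {K : ℝ≥0} {E : ℝ≥0∞} (hE : ∀ n, ∫⁻ x, (‖deriv (Mn n) x‖ₑ - K) ≤ E) {ι : Type*} (s : Finset ι)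
    (a b : ι → ℝ) (hd : (s : Set ι).PairwiseDisjoint fun i => uIoc (a i) (b i)) :
    ∑ i ∈ s, edist (M (a i)) (M (b i)) ≤ E + K * ∑ i ∈ s, edist (a i) (b i) := by
  refine le_of_tendsto (tendsto_finsetSum s fun i _ => (hlim (a i)).edist (hlim (b i)))
    (Eventually.of_forall fun n => ((hL n).sum_edist_le s a b hd K).trans ?_)
  gcongr
  exact hE n

/-- The bounds `η K` are uniform in `n` and tend to zero, so they act as uniform integrability of
the derivatives of the approximants. -/
theorem absolutelyContinuousOnInterval_of_tendsto (hL : ∀ n, LipschitzWith (L n) (Mn n))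
    (hlim : ∀ x, Tendsto (fun n => Mn n x) atTop (𝓝 (M x)))
    (hE : ∀ (K : ℝ≥0) n, ∫⁻ x, (‖deriv (Mn n) x‖ₑ - K) ≤ η K) (hη : Tendsto η atTop (𝓝 0)) (a b : ℝ) :
    AbsolutelyContinuousOnInterval M a b := by
  rw [absolutelyContinuousOnInterval_iff]
  intro ε hε
  have hε2 : (0 : ℝ≥0∞) < ENNReal.ofReal (ε / 2) := by simpa using hε
  obtain ⟨K, hK⟩ := (hη.eventually (gt_mem_nhds hε2)).exists
  -- `K + 1` rather than `K`, since `K` may be zero.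
  refine ⟨ε / 2 / (K + 1), by positivity, fun E hE' hlt => ?_⟩
  have key := sum_edist_le_of_tendsto hL hlim (hE K) (Finset.range E.1) (fun i => (E.2 i).1)
    (fun i => (E.2 i).2) hE'.2
  have hconv : ∀ w : ℝ → ℝ, ∑ i ∈ Finset.range E.1, edist (w (E.2 i).1) (w (E.2 i).2) =
      ENNReal.ofReal (∑ i ∈ Finset.range E.1, dist (w (E.2 i).1) (w (E.2 i).2)) := fun w => by
    rw [ENNReal.ofReal_sum_of_nonneg fun _ _ => dist_nonneg]
    simp_rw [edist_dist]
  have h1 := hconv M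
  have h2 := hconv id
  simp only [id] at h2
  rw [h1, h2] at key
  have h3 : (K : ℝ≥0∞) * ENNReal.ofReal (∑ i ∈ Finset.range E.1, dist (E.2 i).1 (E.2 i).2) ≤
      ENNReal.ofReal (ε / 2) := by
    rw [← ENNReal.ofReal_coe_nnreal, ← ENNReal.ofReal_mul K.coe_nonneg]
    refine ENNReal.ofReal_le_ofReal ?_
    have hS : 0 ≤ ∑ i ∈ Finset.range E.1, dist (E.2 i).1 (E.2 i).2 :=
      Finset.sum_nonneg fun _ _ => dist_nonneg
    rw [lt_div_iff₀ (by positivity)] at hlt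
    nlinarith
  have h4 : ENNReal.ofReal (∑ i ∈ Finset.range E.1, dist (M (E.2 i).1) (M (E.2 i).2)) <
      ENNReal.ofReal ε := by
    refine key.trans_lt ?_
    calc η K + _ < ENNReal.ofReal (ε / 2) + ENNReal.ofReal (ε / 2) :=
          ENNReal.add_lt_add_of_lt_of_le (ne_top_of_le_ne_top ENNReal.ofReal_ne_top h3) hK h3
      _ = ENNReal.ofReal ε := by
          rw [← ENNReal.ofReal_add (by positivity) (by positivity), add_halves]
  exact (ENNReal.ofReal_lt_ofReal_iff hε).1 h4

/-- No convergence of derivatives is required: at a fixed step `h` the difference quotients converge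
pointwise and Fatou applies in `n`; only then does `h` tend to zero. -/
theorem lintegral_deriv_tsub_le_of_tendsto (hL : ∀ n, LipschitzWith (L n) (Mn n))
    (hlim : ∀ x, Tendsto (fun n => Mn n x) atTop (𝓝 (M x))) (hM : Continuous M)
    (hd : ∀ᵐ x, DifferentiableAt ℝ M x) {K E : ℝ≥0∞}
    (hE : ∀ n, ∫⁻ x, (‖deriv (Mn n) x‖ₑ - K) ≤ E) : ∫⁻ x, (‖deriv M x‖ₑ - K) ≤ E := by
  refine lintegral_deriv_tsub_le_of_slope hM hd fun h hh => ?_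
  calc ∫⁻ x, (‖h⁻¹ • (M (x + h) - M x)‖ₑ - K)
      = ∫⁻ x, liminf (fun n => ‖h⁻¹ • (Mn n (x + h) - Mn n x)‖ₑ - K) atTop := by
        refine lintegral_congr fun x => (Tendsto.liminf_eq ?_).symm
        exact ENNReal.Tendsto.sub (((hlim _).sub (hlim _)).const_smul _).enorm tendsto_const_nhds
          (Or.inl enorm_ne_top)
    _ ≤ liminf (fun n => ∫⁻ x, (‖h⁻¹ • (Mn n (x + h) - Mn n x)‖ₑ - K)) atTop := by
        refine lintegral_liminf_le fun n => Measurable.sub ?_ measurable_const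
        have := (hL n).continuous
        exact (Continuous.measurable (by fun_prop)).enorm
    _ ≤ E := by
        refine liminf_le_of_frequently_le' (Eventually.frequently (Eventually.of_forall fun n => ?_))
        refine (lintegral_slope_tsub_le (v := deriv (Mn n))
          (measurable_deriv _).aestronglyMeasurable hh (ae_of_all _ fun x => ?_) K).trans (hE n)
        rw [← edist_eq_enorm_sub, edist_comm]
        have := (hL n).edist_le_lintegral_deriv x (x + h)
        rwa [uIoc_of_le (by linarith)] at this

end

/-! ### Truncated integrals of `L^p` functions. -/

section
variable {E : Type*} [NormedAddCommGroup E] {v : ℝ → E} {p : ℝ≥0∞}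

theorem lintegral_enorm_tsub_lt_top (hp1 : 1 ≤ p) (hp : p ≠ ⊤) (hv : MemLp v p volume) {c : ℝ≥0}
    (hc : 0 < c) : ∫⁻ x, (‖v x‖ₑ - c) < ⊤ := by
  have hc0 : (c : ℝ≥0∞) ≠ 0 := by exact_mod_cast hc.ne'
  have hp1' : 1 ≤ p.toReal := by simpa using ENNReal.toReal_mono hp hp1
  -- Where `s > c`, the ratio `s / c` exceeds 1 and is at most its `p`-th power.
  have hb : ∀ s : ℝ≥0∞, s - c ≤ c * ((c : ℝ≥0∞) ^ p.toReal)⁻¹ * s ^ p.toReal := by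
    intro s
    rcases le_total s c with h | h
    · simp [tsub_eq_zero_of_le h]
    · have h1 : 1 ≤ s / c := by rwa [ENNReal.le_div_iff_mul_le (Or.inl hc0) (Or.inl (by simp)), one_mul]
      calc s - c ≤ s := tsub_le_self
        _ = c * (s / c) := (ENNReal.mul_div_cancel hc0 (by simp)).symm
        _ ≤ c * (s / c) ^ p.toReal := by
            gcongr
            simpa using ENNReal.rpow_le_rpow_of_exponent_le h1 hp1'
        _ = _ := by
            rw [ENNReal.div_rpow_of_nonneg _ _ (by positivity), div_eq_mul_inv]
            ring
  have hfin : ∫⁻ x, ‖v x‖ₑ ^ p.toReal < ⊤ :=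
    lintegral_rpow_enorm_lt_top_of_eLpNorm_lt_top (by positivity) hp hv.2
  refine (lintegral_mono fun x => hb _).trans_lt ?_
  have hne : (c : ℝ≥0∞) * ((c : ℝ≥0∞) ^ p.toReal)⁻¹ ≠ ⊤ :=
    ENNReal.mul_ne_top (by simp) (by simp [hc.ne'])
  rw [lintegral_const_mul' _ _ hne]
  exact ENNReal.mul_lt_top hne.lt_top hfin

theorem tendsto_lintegral_enorm_tsub (hp1 : 1 ≤ p) (hp : p ≠ ⊤) (hv : MemLp v p volume) :
    Tendsto (fun K : ℝ≥0 => ∫⁻ x, (‖v x‖ₑ - K)) atTop (𝓝 0) := by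
  have h0 : ∫⁻ _ : ℝ, (0 : ℝ≥0∞) = 0 := by simp
  rw [← h0]
  refine tendsto_lintegral_filter_of_dominated_convergence' (fun x => ‖v x‖ₑ - (1 : ℝ≥0)) ?_ ?_
    (lintegral_enorm_tsub_lt_top hp1 hp hv one_pos).ne ?_
  · exact Eventually.of_forall fun K => hv.1.enorm.sub aemeasurable_const
  · filter_upwards [eventually_ge_atTop 1] with K hK
    exact ae_of_all _ fun x => tsub_le_tsub_left (by exact_mod_cast hK) _
  · refine ae_of_all _ fun x => tendsto_const_nhds.congr' ?_
    filter_upwards [eventually_ge_atTop ‖v x‖₊] with K hK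
    exact (tsub_eq_zero_of_le (by simpa [enorm_eq_nnnorm] using hK)).symm

end

/-! ### Weak derivatives and absolutely continuous representatives. -/

theorem HasCompactSupport.exists_pos_forall_lt_abs_eq_zero {φ : ℝ → ℝ} (hφ : HasCompactSupport φ) :
    ∃ R : ℝ, 0 < R ∧ ∀ x, R ≤ |x| → φ x = 0 := by
  obtain ⟨R, hR⟩ := (isBounded_iff_forall_norm_le.1 hφ.isCompact.isBounded)
  refine ⟨|R| + 1, by positivity, fun x hx => image_eq_zero_of_notMem_tsupport fun hmem => ?_⟩
  have := hR x hmem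
  rw [Real.norm_eq_abs] at this
  linarith [le_abs_self R]

theorem integral_eq_intervalIntegral_of_forall_abs {E : Type*} [NormedAddCommGroup E]
    [NormedSpace ℝ E] {g : ℝ → E} {R : ℝ} (hR : 0 < R) (hg : ∀ x, R ≤ |x| → g x = 0) :
    ∫ x, g x = ∫ x in (-R)..R, g x := by
  rw [intervalIntegral.integral_of_le (by linarith)]
  refine (setIntegral_eq_integral_of_forall_compl_eq_zero fun x hx => hg x ?_).symm
  by_contra! h
  have := abs_lt.1 h
  exact hx ⟨this.1, this.2.le⟩

theorem AbsolutelyContinuousOnInterval.continuous_of_forall {M : ℝ → ℝ}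
    (hM : ∀ a b, AbsolutelyContinuousOnInterval M a b) : Continuous M := by
  rw [continuous_iff_continuousAt]
  intro x
  have h := (hM (x - 1) (x + 1)).continuousOn
  rw [uIcc_of_le (by linarith)] at h
  exact h.continuousAt (Icc_mem_nhds (by linarith) (by linarith))

theorem locallyIntegrable_of_forall_intervalIntegrable {v : ℝ → ℝ}
    (hv : ∀ a b, IntervalIntegrable v volume a b) : LocallyIntegrable v volume := by
  intro x
  refine ⟨Ioc (x - 1) (x + 1), Ioc_mem_nhds (by linarith) (by linarith), ?_⟩
  have := (hv (x - 1) (x + 1)).1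
  exact this

theorem AbsolutelyContinuousOnInterval.hasWeakDeriv_deriv {M : ℝ → ℝ}
    (hM : ∀ a b, AbsolutelyContinuousOnInterval M a b) : HasWeakDeriv M (deriv M) where
  locallyIntegrable := (AbsolutelyContinuousOnInterval.continuous_of_forall hM).locallyIntegrable
  locallyIntegrable_deriv :=
    locallyIntegrable_of_forall_intervalIntegrable fun a b => (hM a b).intervalIntegrable_deriv
  integral_eq := by
    intro φ hφ hφc
    obtain ⟨R, hR, hφR⟩ := hφc.exists_pos_forall_lt_abs_eq_zero
    obtain ⟨R', hR', hφR'⟩ := hφc.deriv.exists_pos_forall_lt_abs_eq_zero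
    have hS : 0 < max R R' := lt_max_of_lt_left hR
    have hφac : AbsolutelyContinuousOnInterval φ (-max R R') (max R R') :=
      (hφ.contDiffOn.of_le (by exact_mod_cast le_top)).absolutelyContinuousOnInterval
    rw [integral_eq_intervalIntegral_of_forall_abs hS fun x hx => by
        rw [hφR' x ((le_max_right _ _).trans hx), zero_smul],
      integral_eq_intervalIntegral_of_forall_abs hS fun x hx => by
        rw [hφR x ((le_max_left _ _).trans hx), zero_smul]]
    simp only [smul_eq_mul]
    rw [hφac.integral_mul_deriv_eq_deriv_mul (hM _ _), hφR _ (by rw [abs_of_pos hS]; exact le_max_left _ _),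
      hφR _ (by rw [abs_neg, abs_of_pos hS]; exact le_max_left _ _)]
    ring

theorem HasWeakDeriv.ae_eq {E : Type*} [NormedAddCommGroup E] [NormedSpace ℝ E] [CompleteSpace E]
    {u v w : ℝ → E} (hv : HasWeakDeriv u v) (hw : HasWeakDeriv u w) : v =ᵐ[volume] w := by
  refine ae_eq_of_integral_contDiff_smul_eq hv.locallyIntegrable_deriv hw.locallyIntegrable_deriv
    fun φ hφ hφc => ?_
  have h1 := hv.integral_eq φ hφ hφc
  rw [hw.integral_eq φ hφ hφc] at h1
  exact (neg_injective h1).symm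

/-- The lemma of du Bois-Reymond. Subtracting from `ψ` its integral times a fixed bump `η` of mass
one leaves a function of mean zero, whose primitive `Φ` has compact support and is an admissible
test function. -/
theorem ae_eq_const_of_forall_integral_deriv_smul_eq_zero {d : ℝ → ℝ}
    (hd : LocallyIntegrable d volume)
    (h : ∀ φ : ℝ → ℝ, ContDiff ℝ ∞ φ → HasCompactSupport φ → ∫ x, deriv φ x • d x = 0) :
    ∃ c, d =ᵐ[volume] fun _ => c := by
  let B : ContDiffBump (0 : ℝ) := ⟨1, 2, one_pos, one_lt_two⟩
  set η : ℝ → ℝ := B.normed volume with hη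
  have hηs : ContDiff ℝ ∞ η := B.contDiff_normed
  have hηc : HasCompactSupport η := B.hasCompactSupport_normed
  have hη1 : ∫ x, η x = 1 := B.integral_normed
  refine ⟨∫ x, η x • d x, ae_eq_of_integral_contDiff_smul_eq hd
    (locallyIntegrable_const _) fun ψ hψ hψc => ?_⟩
  set ρ : ℝ → ℝ := fun x => ψ x - (∫ y, ψ y) * η x with hρ
  have hρs : ContDiff ℝ ∞ ρ := hψ.sub (contDiff_const.mul hηs)
  have hρc : HasCompactSupport ρ := hψc.sub hηc.mul_left
  have hψi : Integrable ψ := hψ.continuous.integrable_of_hasCompactSupport hψc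
  have hηi : Integrable η := hηs.continuous.integrable_of_hasCompactSupport hηc
  have hρ0 : ∫ x, ρ x = 0 := by
    rw [hρ, integral_sub hψi (hηi.const_mul _), integral_const_mul, hη1, mul_one, sub_self]
  obtain ⟨R, hR, hρR⟩ := hρc.exists_pos_forall_lt_abs_eq_zero
  set Φ : ℝ → ℝ := fun x => ∫ y in (-R)..x, ρ y with hΦ
  have hΦd : ∀ x, HasDerivAt Φ (ρ x) x := fun x =>
    intervalIntegral.integral_hasDerivAt_right (hρs.continuous.intervalIntegrable _ _)
      (hρs.continuous.stronglyMeasurableAtFilter _ _) hρs.continuous.continuousAt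
  have hΦderiv : deriv Φ = ρ := funext fun x => (hΦd x).deriv
  have hΦs : ContDiff ℝ ∞ Φ := by
    rw [contDiff_infty_iff_deriv, hΦderiv]
    exact ⟨fun x => (hΦd x).differentiableAt, hρs⟩
  have hΦR : ∀ x, R ≤ x → Φ x = 0 := by
    intro x hx
    have h1 : ∫ y in R..x, ρ y = 0 := by
      rw [intervalIntegral.integral_congr (g := fun _ => (0 : ℝ)), intervalIntegral.integral_zero]
      intro y hy
      rw [uIcc_of_le hx] at hy
      exact hρR y (hy.1.trans (le_abs_self y))
    rw [hΦ]
    simp only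
    rw [← intervalIntegral.integral_add_adjacent_intervals
      (hρs.continuous.intervalIntegrable (-R) R) (hρs.continuous.intervalIntegrable R x), h1,
      ← integral_eq_intervalIntegral_of_forall_abs hR hρR, hρ0, add_zero]
  have hΦR' : ∀ x, x ≤ -R → Φ x = 0 := by
    intro x hx
    rw [hΦ]
    simp only
    rw [intervalIntegral.integral_congr (g := fun _ => (0 : ℝ)), intervalIntegral.integral_zero]
    intro y hy
    rw [uIcc_of_ge hx] at hy
    exact hρR y (by rw [abs_of_nonpos (by linarith [hy.2])]; linarith [hy.2])
  have hΦc : HasCompactSupport Φ := by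
    refine HasCompactSupport.intro (isCompact_Icc (a := -R) (b := R)) fun x hx => ?_
    by_cases h1 : x ≤ -R
    · exact hΦR' x h1
    · refine hΦR x ?_
      by_contra! h2
      exact hx ⟨by linarith, h2.le⟩
  have key := h Φ hΦs hΦc
  rw [hΦderiv] at key
  have hψd : Integrable fun x => ψ x • d x :=
    hd.integrable_smul_left_of_hasCompactSupport hψ.continuous hψc
  have hηd : Integrable fun x => η x • d x :=
    hd.integrable_smul_left_of_hasCompactSupport hηs.continuous hηc
  have e : ∀ x, ρ x • d x = ψ x • d x - (∫ y, ψ y) * (η x • d x) := fun x => by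
    simp only [hρ, smul_eq_mul]
    ring
  simp_rw [e] at key
  rw [integral_sub hψd (hηd.const_mul _), integral_const_mul, sub_eq_zero] at key
  rw [key, integral_smul_const, smul_eq_mul]

theorem MeasureTheory.LocallyIntegrable.intervalIntegrable {E : Type*} [NormedAddCommGroup E]
    {v : ℝ → E} (hv : LocallyIntegrable v volume) (a b : ℝ) : IntervalIntegrable v volume a b :=
  (hv.integrableOn_isCompact isCompact_uIcc).intervalIntegrable

theorem HasWeakDeriv.exists_ae_eq_real {u v : ℝ → ℝ} (h : HasWeakDeriv u v) :
    ∃ c : ℝ, u =ᵐ[volume] fun x => c + ∫ s in (0 : ℝ)..x, v s := by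
  have hv := h.locallyIntegrable_deriv.intervalIntegrable
  set w : ℝ → ℝ := fun x => ∫ s in (0 : ℝ)..x, v s with hw
  have hac : ∀ a b, AbsolutelyContinuousOnInterval w a b := fun a b => by
    have h1 : -(|a| + |b|) ≤ |a| + |b| := by linarith [abs_nonneg a, abs_nonneg b]
    refine ((hv (-(|a| + |b|)) (|a| + |b|)).absolutelyContinuousOnInterval_intervalIntegral
      (c := 0) ?_).mono ?_
    · rw [uIcc_of_le h1]
      exact ⟨by linarith [abs_nonneg a, abs_nonneg b], by positivity⟩
    · refine uIcc_subset_uIcc ?_ ?_ <;> rw [uIcc_of_le h1] <;> constructor <;>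
        linarith [neg_abs_le a, neg_abs_le b, le_abs_self a, le_abs_self b, abs_nonneg a, abs_nonneg b]
  have hwd := AbsolutelyContinuousOnInterval.hasWeakDeriv_deriv hac
  have hdv : deriv w =ᵐ[volume] v :=
    (LocallyIntegrable.ae_hasDerivAt_integral h.locallyIntegrable_deriv).mono fun x hx => (hx 0).deriv
  obtain ⟨c, hc⟩ := ae_eq_const_of_forall_integral_deriv_smul_eq_zero (d := fun x => u x - w x)
    (h.locallyIntegrable.sub hwd.locallyIntegrable) fun φ hφ hφc => by
      have hφ' : ContDiff ℝ ∞ (deriv φ) := (contDiff_infty_iff_deriv.1 hφ).2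
      simp_rw [smul_sub]
      rw [integral_sub (h.locallyIntegrable.integrable_smul_left_of_hasCompactSupport
          hφ'.continuous hφc.deriv)
        (hwd.locallyIntegrable.integrable_smul_left_of_hasCompactSupport
          hφ'.continuous hφc.deriv), h.integral_eq φ hφ hφc, hwd.integral_eq φ hφ hφc,
        integral_congr_ae (g := fun x => φ x • v x)
          (hdv.mono fun x hx => congrArg (φ x • ·) hx), sub_self]
  exact ⟨c, hc.mono fun x hx => by linarith⟩

section
variable {𝕜 : Type*} [RCLike 𝕜] {u v : ℝ → 𝕜}

theorem HasWeakDeriv.realCLM_comp (h : HasWeakDeriv u v) (ℓ : 𝕜 →L[ℝ] ℝ) :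
    HasWeakDeriv (fun x => ℓ (u x)) (fun x => ℓ (v x)) where
  locallyIntegrable x := by
    obtain ⟨s, hs, hi⟩ := h.locallyIntegrable x
    exact ⟨s, hs, ℓ.integrable_comp hi⟩
  locallyIntegrable_deriv x := by
    obtain ⟨s, hs, hi⟩ := h.locallyIntegrable_deriv x
    exact ⟨s, hs, ℓ.integrable_comp hi⟩
  integral_eq φ hφ hφc := by
    have hφ' : ContDiff ℝ ∞ (deriv φ) := (contDiff_infty_iff_deriv.1 hφ).2
    have h1 := ℓ.integral_comp_comm (h.locallyIntegrable.integrable_smul_left_of_hasCompactSupport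
      hφ'.continuous hφc.deriv)
    have h2 := ℓ.integral_comp_comm
      (h.locallyIntegrable_deriv.integrable_smul_left_of_hasCompactSupport hφ.continuous hφc)
    simp only [map_smul] at h1 h2
    rw [h1, h2, h.integral_eq φ hφ hφc, map_neg]

theorem HasWeakDeriv.exists_ae_eq (h : HasWeakDeriv u v) :
    ∃ c : 𝕜, u =ᵐ[volume] fun x => c + ∫ s in (0 : ℝ)..x, v s := by
  obtain ⟨a, ha⟩ := (h.realCLM_comp RCLike.reCLM).exists_ae_eq_real
  obtain ⟨b, hb⟩ := (h.realCLM_comp RCLike.imCLM).exists_ae_eq_real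
  refine ⟨(a : 𝕜) + b * RCLike.I, ?_⟩
  have hv := h.locallyIntegrable_deriv.intervalIntegrable
  filter_upwards [ha, hb] with x hax hbx
  rw [RCLike.reCLM.intervalIntegral_comp_comm (hv 0 x)] at hax
  rw [RCLike.imCLM.intervalIntegral_comp_comm (hv 0 x)] at hbx
  simp only [RCLike.reCLM_apply, RCLike.imCLM_apply] at hax hbx
  rw [← RCLike.re_add_im (u x), hax, hbx]
  conv_rhs => rw [← RCLike.re_add_im (∫ s in (0 : ℝ)..x, v s)]
  push_cast
  ring

theorem HasWeakDeriv.exists_continuous_ae_eq (h : HasWeakDeriv u v) :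
    ∃ w : ℝ → 𝕜, Continuous w ∧ u =ᵐ[volume] w ∧
      ∀ a b, a ≤ b → ‖w b - w a‖ₑ ≤ ∫⁻ s in Ioc a b, ‖v s‖ₑ := by
  obtain ⟨c, hc⟩ := h.exists_ae_eq
  have hv := h.locallyIntegrable_deriv.intervalIntegrable
  refine ⟨fun x => c + ∫ s in (0 : ℝ)..x, v s, continuous_const.add (intervalIntegral.continuous_primitive hv 0), hc,
    fun a b hab => ?_⟩
  beta_reduce
  rw [add_sub_add_left_eq_sub, intervalIntegral.integral_interval_sub_left (hv _ _) (hv _ _),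
    intervalIntegral.integral_of_le hab]
  exact enorm_integral_le_lintegral_enorm _

end

/-! ### Recovering `L^p` norms from truncated integrals. -/

/-- This writes `r ^ p` as a positive superposition of the functions `(r - t)₊`, so bounds on all
truncated integrals add up to a bound on the `p`-th moment. -/
theorem lintegral_rpow_mul_ofReal_sub {p : ℝ} (hp : 1 < p) {r : ℝ} (hr : 0 ≤ r) :
    ∫⁻ t in Ioi (0 : ℝ), ENNReal.ofReal (t ^ (p - 2)) * (ENNReal.ofReal r - ENNReal.ofReal t) =
      ENNReal.ofReal (1 / (p * (p - 1))) * ENNReal.ofReal r ^ p := by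
  have hp0 : 0 < p := by linarith
  have hp1 : 0 < p - 1 := by linarith
  have h1 : IntervalIntegrable (fun t : ℝ => r * t ^ (p - 2)) volume 0 r :=
    (intervalIntegral.intervalIntegrable_rpow' (by linarith)).const_mul r
  have h2 : IntervalIntegrable (fun t : ℝ => t ^ (p - 1)) volume 0 r :=
    intervalIntegral.intervalIntegrable_rpow' (by linarith)
  have hval : ∫ t in (0 : ℝ)..r, (r * t ^ (p - 2) - t ^ (p - 1)) = 1 / (p * (p - 1)) * r ^ p := by
    rw [intervalIntegral.integral_sub h1 h2, intervalIntegral.integral_const_mul,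
      integral_rpow (Or.inl (by linarith)), integral_rpow (Or.inl (by linarith)),
      show p - 2 + 1 = p - 1 by ring, show p - 1 + 1 = p by ring, Real.zero_rpow hp1.ne',
      Real.zero_rpow hp0.ne', sub_zero, sub_zero]
    have h3 : r * (r ^ (p - 1) / (p - 1)) = r ^ p / (p - 1) := by
      rcases hr.eq_or_lt with rfl | hr0
      · simp [Real.zero_rpow hp0.ne']
      · rw [Real.rpow_sub_one hr0.ne']
        field_simp
    rw [h3]
    field_simp
    ring
  have hnn : ∀ t ∈ Ioc 0 r, 0 ≤ r * t ^ (p - 2) - t ^ (p - 1) ∧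
      t ^ (p - 2) * (r - t) = r * t ^ (p - 2) - t ^ (p - 1) := by
    intro t ht
    have e : t ^ (p - 1) = t ^ (p - 2) * t := by
      rw [show p - 1 = p - 2 + 1 by ring, Real.rpow_add_one ht.1.ne']
    have e2 : t ^ (p - 2) * (r - t) = r * t ^ (p - 2) - t ^ (p - 1) := by rw [e]; ring
    refine ⟨?_, e2⟩
    rw [← e2]
    exact mul_nonneg (Real.rpow_nonneg ht.1.le _) (by linarith [ht.2])
  calc ∫⁻ t in Ioi (0 : ℝ), ENNReal.ofReal (t ^ (p - 2)) * (ENNReal.ofReal r - ENNReal.ofReal t)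
      = ∫⁻ t in Ioc 0 r, ENNReal.ofReal (t ^ (p - 2)) * (ENNReal.ofReal r - ENNReal.ofReal t) := by
        rw [← lintegral_indicator measurableSet_Ioi, ← lintegral_indicator measurableSet_Ioc]
        refine lintegral_congr fun t => ?_
        by_cases h : t ∈ Ioc 0 r
        · rw [indicator_of_mem h, indicator_of_mem (show t ∈ Ioi 0 from h.1)]
        · rw [indicator_of_notMem h]
          by_cases h0 : t ∈ Ioi (0 : ℝ)
          · have hrt : r ≤ t := by
              by_contra! hlt
              exact h ⟨h0, hlt.le⟩
            rw [indicator_of_mem h0, tsub_eq_zero_of_le (ENNReal.ofReal_le_ofReal hrt), mul_zero]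
          · rw [indicator_of_notMem h0]
    _ = ∫⁻ t in Ioc 0 r, ENNReal.ofReal (r * t ^ (p - 2) - t ^ (p - 1)) := by
        refine setLIntegral_congr_fun measurableSet_Ioc fun t ht => ?_
        rw [← ENNReal.ofReal_sub _ ht.1.le, ← ENNReal.ofReal_mul (Real.rpow_nonneg ht.1.le _),
          (hnn t ht).2]
    _ = ENNReal.ofReal (∫ t in (0 : ℝ)..r, (r * t ^ (p - 2) - t ^ (p - 1))) := by
        rw [intervalIntegral.integral_of_le hr, ofReal_integral_eq_lintegral_ofReal (h1.sub h2).1]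
        exact (ae_restrict_mem measurableSet_Ioc).mono fun t ht => (hnn t ht).1
    _ = _ := by
        rw [hval, ENNReal.ofReal_mul (by positivity), ENNReal.ofReal_rpow_of_nonneg hr hp0.le]

theorem lintegral_rpow_mul_lintegral_tsub {F : ℝ → ℝ≥0∞} (hF : AEMeasurable F)
    (hF' : ∀ x, F x ≠ ⊤) {p : ℝ} (hp : 1 < p) :
    ∫⁻ t in Ioi (0 : ℝ), ENNReal.ofReal (t ^ (p - 2)) * ∫⁻ x, (F x - ENNReal.ofReal t) =
      ENNReal.ofReal (1 / (p * (p - 1))) * ∫⁻ x, F x ^ p := by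
  have hm : Measurable fun t : ℝ => ENNReal.ofReal (t ^ (p - 2)) :=
    (measurable_id.pow_const (p - 2)).ennreal_ofReal
  calc _ = ∫⁻ t in Ioi (0 : ℝ), ∫⁻ x, ENNReal.ofReal (t ^ (p - 2)) * (F x - ENNReal.ofReal t) := by
        refine lintegral_congr fun t => ?_
        rw [lintegral_const_mul' _ _ ENNReal.ofReal_ne_top]
    _ = ∫⁻ x, ∫⁻ t in Ioi (0 : ℝ), ENNReal.ofReal (t ^ (p - 2)) * (F x - ENNReal.ofReal t) := by
        refine lintegral_lintegral_swap ?_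
        exact (hm.comp measurable_fst).aemeasurable.mul
          ((hF.comp_snd).sub (ENNReal.measurable_ofReal.comp measurable_fst).aemeasurable)
    _ = ∫⁻ x, ENNReal.ofReal (1 / (p * (p - 1))) * F x ^ p := by
        refine lintegral_congr fun x => ?_
        have := lintegral_rpow_mul_ofReal_sub hp (r := (F x).toReal) ENNReal.toReal_nonneg
        rwa [ENNReal.ofReal_toReal (hF' x)] at this
    _ = _ := by rw [lintegral_const_mul' _ _ ENNReal.ofReal_ne_top]

theorem eLpNorm_le_of_forall_lintegral_tsub_le {E E' : Type*} [NormedAddCommGroup E]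
    [NormedAddCommGroup E'] {w : ℝ → E} {v : ℝ → E'} (hw : AEStronglyMeasurable w volume)
    (hv : AEStronglyMeasurable v volume) {p : ℝ≥0∞} (hp1 : 1 ≤ p) (hp : p ≠ ⊤)
    (h : ∀ K : ℝ≥0, ∫⁻ x, (‖w x‖ₑ - K) ≤ ∫⁻ x, (‖v x‖ₑ - K)) :
    eLpNorm w p volume ≤ eLpNorm v p volume := by
  rcases hp1.eq_or_lt with rfl | hp1'
  · simpa [eLpNorm_one_eq_lintegral_enorm] using h 0
  have hpr : 1 < p.toReal := by simpa using (ENNReal.toReal_lt_toReal (by simp) hp).2 hp1'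
  have hp0 : p ≠ 0 := (zero_lt_one.trans hp1').ne'
  rw [eLpNorm_eq_lintegral_rpow_enorm_toReal hp0 hp, eLpNorm_eq_lintegral_rpow_enorm_toReal hp0 hp]
  refine ENNReal.rpow_le_rpow ?_ (by positivity)
  have hc : 0 < 1 / (p.toReal * (p.toReal - 1)) := by
    have : 0 < p.toReal - 1 := by linarith
    positivity
  rw [← ENNReal.mul_le_mul_iff_right (a := ENNReal.ofReal (1 / (p.toReal * (p.toReal - 1))))
    (by simpa using hc) ENNReal.ofReal_ne_top,
    ← lintegral_rpow_mul_lintegral_tsub hw.enorm (fun _ => enorm_ne_top) hpr,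
    ← lintegral_rpow_mul_lintegral_tsub hv.enorm (fun _ => enorm_ne_top) hpr]
  refine lintegral_mono fun t => mul_le_mul_right ?_ _
  exact h t.toNNReal

/-! ### The weak type `(1, 1)` estimate and membership in `L^p`. -/

section
variable {F : ℝ → ℝ≥0∞} {α : ℝ}

/-- Dyadic decomposition. For the least `k` with `|y - z| ≤ 2 ^ k * t`, minimality gives `|y - z| >
2 ^ (k - 1) * t` when `k > 0`; losing one dyadic step costs the factor 4. -/
theorem ofReal_poissonKernel1D_le_tsum (y z : ℝ) {t : ℝ} (ht : 0 < t) :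
    ENNReal.ofReal (poissonKernel1D (y - z) t) ≤ ∑' k : ℕ,
      (Metric.closedBall y (2 ^ k * t)).indicator
        (fun _ => ENNReal.ofReal (4 * (1 / 4) ^ k / t)) z := by
  obtain ⟨k0, hk0⟩ := pow_unbounded_of_one_lt (|y - z| / t) (one_lt_two (α := ℝ))
  have hex : ∃ k : ℕ, |y - z| ≤ 2 ^ k * t := ⟨k0, ((div_lt_iff₀ ht).1 hk0).le⟩
  classical
  set k := Nat.find hex with hk
  have hkle : |y - z| ≤ 2 ^ k * t := Nat.find_spec hex
  refine le_trans ?_ (ENNReal.le_tsum k)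
  rw [indicator_of_mem (by rwa [Metric.mem_closedBall, dist_comm, Real.dist_eq])]
  refine ENNReal.ofReal_le_ofReal ?_
  have hpi : poissonKernel1D (y - z) t ≤ t / ((y - z) ^ 2 + t ^ 2) := by
    unfold poissonKernel1D
    refine mul_le_of_le_one_left (by positivity) ?_
    rw [div_le_one Real.pi_pos]
    linarith [Real.pi_gt_three]
  refine hpi.trans ?_
  rw [div_le_div_iff₀ (by positivity) ht]
  rcases Nat.eq_zero_or_pos k with h0 | h0
  · rw [h0]
    nlinarith [sq_nonneg (y - z)]
  · obtain ⟨j, hj⟩ : ∃ j, k = j + 1 := ⟨k - 1, by omega⟩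
    have hjlt : 2 ^ j * t < |y - z| := by
      have := Nat.find_min hex (m := j) (by omega)
      simpa using this
    have h1 : (2 ^ j * t) ^ 2 ≤ (y - z) ^ 2 := by
      rw [← sq_abs (y - z)]
      gcongr
    have h2 : (1 / 4 : ℝ) ^ j * (2 ^ j) ^ 2 = 1 := by
      rw [← pow_mul, mul_comm j 2, pow_mul, ← mul_pow]
      norm_num
    have h3 : (0 : ℝ) < (1 / 4) ^ j := by positivity
    rw [hj, pow_succ]
    calc t * t = (1 / 4 : ℝ) ^ j * (2 ^ j) ^ 2 * t ^ 2 := by rw [h2]; ring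
      _ = (1 / 4 : ℝ) ^ j * (2 ^ j * t) ^ 2 := by ring
      _ ≤ (1 / 4 : ℝ) ^ j * (y - z) ^ 2 := by gcongr
      _ ≤ _ := by nlinarith [sq_nonneg t]

/-- The `k`-th dyadic term contributes at most `4 * 2 ^ (-k) * Λ`, and these sum to `8 * Λ`. -/
theorem poissonAverage_le_of_forall_closedBall (hF : AEMeasurable F) {y t : ℝ} (ht : 0 < t)
    {Λ : ℝ≥0∞} (h : ∀ r, t ≤ r → ∫⁻ z in Metric.closedBall y r, F z ≤ Λ * ENNReal.ofReal r) :
    poissonAverage F y t ≤ 8 * Λ := by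
  calc poissonAverage F y t
      ≤ ∫⁻ z, ∑' k : ℕ, (Metric.closedBall y (2 ^ k * t)).indicator
          (fun z => ENNReal.ofReal (4 * (1 / 4) ^ k / t) * F z) z := by
        refine lintegral_mono fun z => ?_
        refine (mul_le_mul_left (ofReal_poissonKernel1D_le_tsum y z ht) _).trans (le_of_eq ?_)
        rw [← ENNReal.tsum_mul_right]
        refine tsum_congr fun k => ?_
        by_cases hz : z ∈ Metric.closedBall y (2 ^ k * t)
        · rw [indicator_of_mem hz, indicator_of_mem hz]
        · rw [indicator_of_notMem hz, indicator_of_notMem hz, zero_mul]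
    _ = ∑' k : ℕ, ENNReal.ofReal (4 * (1 / 4) ^ k / t) *
          ∫⁻ z in Metric.closedBall y (2 ^ k * t), F z := by
        rw [lintegral_tsum fun k => (hF.const_mul _).indicator Metric.isClosed_closedBall.measurableSet]
        refine tsum_congr fun k => ?_
        rw [lintegral_indicator Metric.isClosed_closedBall.measurableSet,
          lintegral_const_mul' _ _ ENNReal.ofReal_ne_top]
    _ ≤ ∑' k : ℕ, ENNReal.ofReal (4 * (1 / 4) ^ k / t) * (Λ * ENNReal.ofReal (2 ^ k * t)) := by
        gcongr with k
        refine h _ (le_mul_of_one_le_left ht.le (one_le_pow₀ one_le_two))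
    _ = ∑' k : ℕ, ENNReal.ofReal (4 * (1 / 2) ^ k) * Λ := by
        refine tsum_congr fun k => ?_
        rw [mul_comm Λ, ← mul_assoc, ← ENNReal.ofReal_mul (by positivity)]
        congr 2
        have : (1 / 4 : ℝ) ^ k * 2 ^ k = (1 / 2) ^ k := by rw [← mul_pow]; norm_num
        rw [← this]
        field_simp
    _ = 8 * Λ := by
        rw [ENNReal.tsum_mul_right]
        congr 1
        have hs : Summable fun k : ℕ => (4 : ℝ) * (1 / 2) ^ k := summable_geometric_two.mul_left 4
        rw [← ENNReal.ofReal_tsum_of_nonneg (fun k => by positivity) hs, tsum_mul_left,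
          tsum_geometric_two]
        norm_num

/-- The weak type `(1, 1)` bound. -/
theorem volume_lt_coneSup_le (hα : 0 ≤ α) (hF : AEMeasurable F) {l : ℝ} (hl : 0 < l) :
    volume {x | ENNReal.ofReal l < coneSup α F x} ≤
      ENNReal.ofReal (80 * (1 + α) / l) * ∫⁻ x, F x := by
  by_cases hfin : ∫⁻ x, F x = ⊤
  · rw [hfin, ENNReal.mul_top]
    · exact le_top
    · simp only [ne_eq, ENNReal.ofReal_eq_zero, not_le]
      positivity
  set S := {x | ENNReal.ofReal l < coneSup α F x} with hS
  -- A ball of radius `r ≥ t` about `y` lies in the ball of radius `(1 + α) * r` about `x`. The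
  -- factor 8 is that of `poissonAverage_le_of_forall_closedBall`, so masses below `κ * ρ` on all
  -- balls about `x` would force the Poisson average to be at most `l`.
  set κ := l / (8 * (1 + α)) with hκ
  have hκ0 : 0 < κ := by positivity
  have hball : ∀ x ∈ S, ∃ ρ, 0 < ρ ∧
      ENNReal.ofReal (κ * ρ) ≤ ∫⁻ z in Metric.closedBall x ρ, F z := by
    intro x hx
    obtain ⟨t, ht, y, hy, hlt⟩ := lt_coneSup_iff.1 hx
    by_contra! hcon
    refine absurd hlt (not_lt.2 ?_)
    have := poissonAverage_le_of_forall_closedBall hF ht (y := y) (Λ := ENNReal.ofReal (l / 8))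
      fun r hr => by
        have hr0 : 0 < r := ht.trans_le hr
        have h1 := hcon ((1 + α) * r) (by positivity)
        have h2 : κ * ((1 + α) * r) = l / 8 * r := by rw [hκ]; field_simp
        rw [h2, ENNReal.ofReal_mul (by positivity)] at h1
        refine (lintegral_mono_set (Metric.closedBall_subset_closedBall' ?_)).trans h1.le
        rw [Real.dist_eq]
        nlinarith
    refine this.trans (le_of_eq ?_)
    rw [show (8 : ℝ≥0∞) = ENNReal.ofReal 8 by norm_num, ← ENNReal.ofReal_mul (by norm_num)]
    congr 1
    ring
  choose! ρ hρ0 hρ using hball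
  -- Vitali covering with enlargement 5: the enlarged balls have length `10 * ρ`, and `10 / κ = 80 *
  -- (1 + α) / l`.
  obtain ⟨u, huS, hud, huc⟩ := Vitali.exists_disjoint_subfamily_covering_enlargement_closedBall
    S id ρ ((∫⁻ x, F x).toReal / κ) (fun x hx => by
      rw [le_div_iff₀ hκ0, mul_comm, ← ENNReal.ofReal_le_iff_le_toReal hfin]
      exact (hρ x hx).trans (setLIntegral_le_lintegral _ _)) 5 (by norm_num)
  have hucount : u.Countable := by
    refine hud.countable_of_nonempty_interior fun x hx => ?_
    rw [interior_closedBall _ (hρ0 x (huS hx)).ne']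
    exact Metric.nonempty_ball.2 (hρ0 x (huS hx))
  have hcov : S ⊆ ⋃ b ∈ u, Metric.closedBall b (5 * ρ b) := by
    intro x hx
    obtain ⟨b, hb, hsub⟩ := huc x hx
    exact mem_biUnion hb (hsub (Metric.mem_closedBall_self (hρ0 x hx).le))
  have : Countable u := hucount
  calc volume S ≤ ∑' b : u, volume (Metric.closedBall (b : ℝ) (5 * ρ b)) :=
        (measure_mono hcov).trans (measure_biUnion_le _ hucount _)
    _ ≤ ∑' b : u, ENNReal.ofReal (80 * (1 + α) / l) *
          ∫⁻ z in Metric.closedBall (b : ℝ) (ρ b), F z := by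
        gcongr with b
        rw [Real.volume_closedBall]
        refine le_trans (le_of_eq ?_) (mul_le_mul_right (hρ b (huS b.2)) _)
        rw [← ENNReal.ofReal_mul (by positivity)]
        congr 1
        rw [hκ]
        field_simp
        ring
    _ = ENNReal.ofReal (80 * (1 + α) / l) *
          ∫⁻ z in ⋃ b ∈ u, Metric.closedBall b (ρ b), F z := by
        rw [ENNReal.tsum_mul_left, lintegral_biUnion hucount
          (fun b _ => Metric.isClosed_closedBall.measurableSet) (show u.PairwiseDisjoint
            fun b => Metric.closedBall b (ρ b) from hud)]
    _ ≤ _ := by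
        gcongr
        exact Measure.restrict_le_self

theorem coneSup_le_coneSup_tsub_add (c : ℝ≥0∞) (x : ℝ) :
    coneSup α F x ≤ coneSup α (fun z => F z - c) x + c :=
  (coneSup_mono_ae (ae_of_all _ fun _ => le_tsub_add) x).trans (coneSup_add_const_le _ c x)

/-- Marcinkiewicz interpolation between weak `L¹` and `L^∞`: where the maximal function exceeds `t`,
that of `(‖u‖ - t / 2)₊` exceeds `t / 2`. The weak type bound is then integrated in `t`. -/
theorem memLp_nontangentialMaximal {E : Type*} [NormedAddCommGroup E] {u : ℝ → E} {p : ℝ≥0∞}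
    (hα : 0 ≤ α) (hp1 : 1 < p) (hp : p ≠ ⊤) (hu : MemLp u p volume)
    (hfin : ∀ x, nontangentialMaximalENN α u x < ⊤)
    (hmeas : Measurable (nontangentialMaximal α u)) :
    MemLp (nontangentialMaximal α u) p volume := by
  have hpr : 1 < p.toReal := by simpa using (ENNReal.toReal_lt_toReal (by simp) hp).2 hp1
  have hp0 : p ≠ 0 := (zero_lt_one.trans hp1).ne'
  set q := p.toReal with hq
  refine ⟨hmeas.aestronglyMeasurable, ?_⟩
  have hnn : ∀ x, 0 ≤ nontangentialMaximal α u x := fun x => ENNReal.toReal_nonneg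
  rw [eLpNorm_lt_top_iff_lintegral_rpow_enorm_lt_top hp0 hp]
  have e1 : ∀ x, ‖nontangentialMaximal α u x‖ₑ ^ q =
      ENNReal.ofReal (nontangentialMaximal α u x ^ q) := fun x => by
    rw [Real.enorm_eq_ofReal (hnn x), ENNReal.ofReal_rpow_of_nonneg (hnn x) (by linarith)]
  simp_rw [← hq, e1]
  rw [lintegral_rpow_eq_lintegral_meas_lt_mul volume (ae_of_all _ hnn) hmeas.aemeasurable
    (by linarith)]
  refine ENNReal.mul_lt_top ENNReal.ofReal_lt_top ?_
  have hFm : AEMeasurable (fun z => 2 * ‖u z‖ₑ) := hu.1.enorm.const_mul 2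
  have hFt : ∀ z, 2 * ‖u z‖ₑ ≠ ⊤ := fun z => ENNReal.mul_ne_top (by simp) enorm_ne_top
  have hmain : ∀ t ∈ Ioi (0 : ℝ), volume {x | t < nontangentialMaximal α u x} *
      ENNReal.ofReal (t ^ (q - 1)) ≤ ENNReal.ofReal (160 * (1 + α)) *
        (ENNReal.ofReal (t ^ (q - 2)) * ∫⁻ z, (2 * ‖u z‖ₑ - ENNReal.ofReal t)) := by
    intro t ht
    have ht0 : 0 < t := ht
    have hsub : {x | t < nontangentialMaximal α u x} ⊆
        {x | ENNReal.ofReal (t / 2) <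
          coneSup α (fun z => ‖u z‖ₑ - ENNReal.ofReal (t / 2)) x} := by
      intro x hx
      have hx' : ENNReal.ofReal t < coneSup α (fun z => ‖u z‖ₑ) x := by
        rw [← nontangentialMaximalENN_eq_coneSup]
        exact (ENNReal.ofReal_lt_iff_lt_toReal ht0.le (hfin x).ne).2 hx
      have h1 := hx'.trans_le (coneSup_le_coneSup_tsub_add (ENNReal.ofReal (t / 2)) x)
      have e : ENNReal.ofReal t = ENNReal.ofReal (t / 2) + ENNReal.ofReal (t / 2) := by
        rw [← ENNReal.ofReal_add (by positivity) (by positivity), add_halves]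
      rw [e] at h1
      exact (ENNReal.add_lt_add_iff_right ENNReal.ofReal_ne_top).1 h1
    have h3 := (measure_mono hsub).trans (volume_lt_coneSup_le hα
      (hu.1.enorm.sub aemeasurable_const) (half_pos ht0))
    -- Doubling moves the truncation level from `t / 2` to `t`, the form in which
    -- `lintegral_rpow_mul_lintegral_tsub` applies to `2 * ‖u‖`.
    have h4 : ∫⁻ z, (‖u z‖ₑ - ENNReal.ofReal (t / 2)) ≤
        ∫⁻ z, (2 * ‖u z‖ₑ - ENNReal.ofReal t) := by
      refine lintegral_mono fun z => ?_
      have e : ENNReal.ofReal t = 2 * ENNReal.ofReal (t / 2) := by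
        rw [show (2 : ℝ≥0∞) = ENNReal.ofReal 2 by norm_num, ← ENNReal.ofReal_mul (by norm_num)]
        congr 1
        ring
      rw [e, ← ENNReal.mul_sub (by simp)]
      exact le_mul_of_one_le_left zero_le one_le_two
    calc _ ≤ (ENNReal.ofReal (80 * (1 + α) / (t / 2)) *
          ∫⁻ z, (2 * ‖u z‖ₑ - ENNReal.ofReal t)) * ENNReal.ofReal (t ^ (q - 1)) := by
          gcongr
          exact h3.trans (mul_le_mul_right h4 _)
      _ = ENNReal.ofReal (80 * (1 + α) / (t / 2)) * ENNReal.ofReal (t ^ (q - 1)) *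
          ∫⁻ z, (2 * ‖u z‖ₑ - ENNReal.ofReal t) := by ring
      _ = _ := by
          rw [← mul_assoc, ← ENNReal.ofReal_mul (by positivity), ← ENNReal.ofReal_mul (by positivity)]
          congr 2
          rw [show q - 1 = q - 2 + 1 by ring, Real.rpow_add_one ht0.ne']
          field_simp
          ring
  refine (setLIntegral_mono' measurableSet_Ioi hmain).trans_lt ?_
  rw [lintegral_const_mul' _ _ ENNReal.ofReal_ne_top, lintegral_rpow_mul_lintegral_tsub hFm hFt hpr]
  refine ENNReal.mul_lt_top ENNReal.ofReal_lt_top (ENNReal.mul_lt_top ENNReal.ofReal_lt_top ?_)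
  simp_rw [ENNReal.mul_rpow_of_nonneg _ _ (by linarith : 0 ≤ q)]
  have h2 : (2 : ℝ≥0∞) ^ q ≠ ⊤ := ENNReal.rpow_ne_top_of_nonneg (by linarith) (by simp)
  rw [lintegral_const_mul' _ _ h2]
  exact ENNReal.mul_lt_top h2.lt_top (lintegral_rpow_enorm_lt_top_of_eLpNorm_lt_top hp0 hp hu.2)

end

/-! ### Sobolev data with finite exponent. -/

theorem exists_setLIntegral_abs_ge_lt {r : ℝ → ℝ≥0∞} (hr : ∫⁻ x, r x ≠ ⊤) {c : ℝ≥0∞} (hc : 0 < c) :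
    ∃ A : ℝ, ∫⁻ x in {x | A ≤ |x|}, r x < c := by
  have hm : ∀ A : ℝ, MeasurableSet {x : ℝ | A ≤ |x|} := fun A =>
    measurableSet_le measurable_const measurable_id.abs
  have hanti : Antitone fun n : ℕ => {x : ℝ | (n : ℝ) ≤ |x|} := fun m n hmn x hx =>
    (show (m : ℝ) ≤ n by exact_mod_cast hmn).trans hx
  have hempty : ⋂ n : ℕ, {x : ℝ | (n : ℝ) ≤ |x|} = ∅ := by
    refine eq_empty_of_forall_notMem fun x hx => ?_
    obtain ⟨n, hn⟩ := exists_nat_gt |x|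
    exact absurd (mem_iInter.1 hx n) (not_le.2 hn)
  have := tendsto_measure_iInter_atTop (μ := volume.withDensity r)
    (fun n : ℕ => (hm n).nullMeasurableSet) hanti ⟨0, ?_⟩
  · rw [hempty, measure_empty] at this
    obtain ⟨n, hn⟩ := (this.eventually (gt_mem_nhds hc)).exists
    exact ⟨n, by rwa [Function.comp, withDensity_apply _ (hm n)] at hn⟩
  · rw [withDensity_apply _ (hm _)]
    exact ne_top_of_le_ne_top hr (setLIntegral_le_lintegral _ _)

section
variable {E E' : Type*} [NormedAddCommGroup E] [NormedAddCommGroup E'] {w : ℝ → E} {v : ℝ → E'}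
  {p : ℝ≥0∞}

/-- On a unit interval starting at `x`, `‖w x‖` is at most the mean of `‖w‖ + ‖v‖`. Cutting both
functions at height `c = δ / 3` leaves integrable excesses with joint tail below `c`, which makes `3
* c = δ` in all. -/
theorem exists_norm_le_of_memLp (hp1 : 1 ≤ p) (hp : p ≠ ⊤) (hw : MemLp w p volume)
    (hv : MemLp v p volume) (hwv : ∀ a b, a ≤ b → ‖w b - w a‖ₑ ≤ ∫⁻ s in Ioc a b, ‖v s‖ₑ)
    {δ : ℝ} (hδ : 0 < δ) : ∃ A, ∀ x, A < |x| → ‖w x‖ ≤ δ := by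
  set c : ℝ≥0 := ⟨δ / 3, by positivity⟩ with hc
  have hc0 : 0 < c := by
    rw [← NNReal.coe_pos]
    exact (by positivity : 0 < δ / 3)
  have hfin : ∫⁻ x, ((‖w x‖ₑ - c) + (‖v x‖ₑ - c)) ≠ ⊤ := by
    have hm : AEMeasurable (fun x => ‖w x‖ₑ - (c : ℝ≥0∞)) := hw.1.enorm.sub aemeasurable_const
    rw [lintegral_add_left' hm]
    exact ENNReal.add_ne_top.2 ⟨(lintegral_enorm_tsub_lt_top hp1 hp hw hc0).ne,
      (lintegral_enorm_tsub_lt_top hp1 hp hv hc0).ne⟩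
  obtain ⟨A, hA⟩ := exists_setLIntegral_abs_ge_lt hfin (c := c) (by exact_mod_cast hc0)
  refine ⟨A + 1, fun x hx => ?_⟩
  have hI : Ioc x (x + 1) ⊆ {y | A ≤ |y|} := by
    intro y hy
    have h1 := abs_sub_abs_le_abs_sub x y
    have h2 : |x - y| ≤ 1 := abs_le.2 ⟨by linarith [hy.2], by linarith [hy.1]⟩
    show A ≤ |y|
    linarith
  have hvol : volume (Ioc x (x + 1)) = 1 := by simp
  have key : ‖w x‖ₑ ≤ c + (c + c) := by
    calc ‖w x‖ₑ = ∫⁻ _ in Ioc x (x + 1), ‖w x‖ₑ := by rw [setLIntegral_const, hvol, mul_one]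
      _ ≤ ∫⁻ y in Ioc x (x + 1), (‖w y‖ₑ + ∫⁻ s in Ioc x (x + 1), ‖v s‖ₑ) := by
          refine setLIntegral_mono' measurableSet_Ioc fun y hy => ?_
          have h1 : ‖w x‖ₑ ≤ ‖w y‖ₑ + ‖w y - w x‖ₑ := by
            have := enorm_sub_le (a := w y) (b := w y - w x)
            rwa [sub_sub_cancel] at this
          refine h1.trans (add_le_add_right ((hwv x y hy.1.le).trans ?_) _)
          exact lintegral_mono_set (Ioc_subset_Ioc_right hy.2)
      _ = ∫⁻ y in Ioc x (x + 1), (‖w y‖ₑ + ‖v y‖ₑ) := by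
          rw [lintegral_add_right _ measurable_const, setLIntegral_const, hvol, mul_one,
            lintegral_add_left' hw.1.enorm.restrict]
      _ ≤ ∫⁻ y in Ioc x (x + 1), (((‖w y‖ₑ - c) + (‖v y‖ₑ - c)) + (c + c)) := by
          refine lintegral_mono fun y => ?_
          refine (add_le_add (le_tsub_add (a := (c : ℝ≥0∞))) (le_tsub_add (a := (c : ℝ≥0∞)))).trans
            (le_of_eq ?_)
          ring
      _ ≤ c + (c + c) := by
          rw [lintegral_add_right _ measurable_const, setLIntegral_const, hvol, mul_one]
          gcongr
          exact (lintegral_mono_set hI).trans hA.le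
  have h3 : ‖w x‖₊ ≤ c + (c + c) := by
    rw [enorm_eq_nnnorm] at key
    exact_mod_cast key
  have h4 : ‖w x‖ ≤ δ / 3 + (δ / 3 + δ / 3) := by exact_mod_cast h3
  linarith

end

theorem iSup_ofReal_eq_of_tendsto {f : ℕ → ℝ} (hf : Monotone f) {a : ℝ}
    (h : Tendsto f atTop (𝓝 a)) : ⨆ n, ENNReal.ofReal (f n) = ENNReal.ofReal a :=
  iSup_eq_of_tendsto (fun _ _ hmn => ENNReal.ofReal_le_ofReal (hf hmn)) (ENNReal.tendsto_ofReal h)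

section
variable {E E' : Type*} [NormedAddCommGroup E] [NormedAddCommGroup E'] {w : ℝ → E} {v : ℝ → E'}
  {p : ℝ≥0∞} {α : ℝ}

theorem nontangentialMaximal_sobolev_of_continuous (hα : 0 ≤ α) (hp1 : 1 ≤ p) (hp : p ≠ ⊤)
    (hwc : Continuous w) (hw : MemLp w p volume) (hv : MemLp v p volume)
    (hwv : ∀ a b, a ≤ b → ‖w b - w a‖ₑ ≤ ∫⁻ s in Ioc a b, ‖v s‖ₑ) :
    (∃ B : ℝ≥0, ∀ x, nontangentialMaximalENN α w x ≤ B) ∧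
    (∀ a b, AbsolutelyContinuousOnInterval (nontangentialMaximal α w) a b) ∧
    ∀ K : ℝ≥0, ∫⁻ x, (‖deriv (nontangentialMaximal α w) x‖ₑ - K) ≤ ∫⁻ x, (‖v x‖ₑ - K) := by
  -- Lowering `‖w‖` by `1 / (n + 1)` gives compact support, since `w` vanishes at infinity, without
  -- enlarging any difference quotient; a multiplicative cut-off would disturb the bound by `v`.
  set f : ℕ → ℝ → ℝ := fun n z => max (‖w z‖ - 1 / ((n : ℝ) + 1)) 0 with hf
  have hfc : ∀ n, Continuous (f n) := fun n => (hwc.norm.sub continuous_const).max continuous_const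
  have hf0 : ∀ n z, 0 ≤ f n z := fun n z => le_max_right _ _
  choose A hA using fun n : ℕ => exists_norm_le_of_memLp hp1 hp hw hv hwv
    (δ := 1 / ((n : ℝ) + 1)) (by positivity)
  have hfA : ∀ n z, A n < |z| → f n z = 0 := fun n z hz =>
    max_eq_right (by linarith [hA n z hz])
  have hfi : ∀ n, Integrable (f n) := fun n => (hfc n).integrable_of_hasCompactSupport
    (HasCompactSupport.intro (isCompact_Icc (a := -A n) (b := A n)) fun x hx => hfA n x (by
      by_contra! h
      exact hx (abs_le.1 h)))
  have hmono : Monotone f := fun m n hmn z =>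
    max_le_max_right 0 (sub_le_sub_left (Nat.one_div_le_one_div hmn) _)
  have hsup : ∀ z, ⨆ n, ENNReal.ofReal (f n z) = ‖w z‖ₑ := fun z => by
    rw [← ofReal_norm]
    refine iSup_ofReal_eq_of_tendsto (fun m n hmn => hmono hmn z) ?_
    have h1 := ((tendsto_const_nhds (x := ‖w z‖)).sub
      (tendsto_one_div_add_atTop_nhds_zero_nat (𝕜 := ℝ))).max (tendsto_const_nhds (x := (0 : ℝ)))
    rwa [sub_zero, max_eq_left (norm_nonneg _)] at h1
  obtain ⟨B, hB⟩ : ∃ B : ℝ≥0, ∀ x, ‖w x‖ₑ ≤ B := by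
    obtain ⟨B1, hB1⟩ := (isCompact_Icc (a := -A 0) (b := A 0)).exists_bound_of_continuousOn
      hwc.continuousOn
    refine ⟨(max B1 1).toNNReal, fun x => ?_⟩
    rw [← ofReal_norm]
    refine ENNReal.ofReal_le_ofReal ?_
    by_cases h : A 0 < |x|
    · exact (hA 0 x h).trans (by simp)
    · exact (hB1 x (abs_le.1 (not_lt.1 h))).trans (le_max_left _ _)
  have hbdd : ∀ x, nontangentialMaximalENN α w x ≤ B := fun x =>
    coneSup_le_const (ae_of_all _ hB) x
  have hfin : ∀ x, coneSup α (fun z => ‖w z‖ₑ) x < ⊤ := fun x =>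
    (hbdd x).trans_lt ENNReal.coe_lt_top
  set ε : ℕ → ℝ := fun n => 1 / ((n : ℝ) + 1) with hε
  have hε0 : ∀ n, 0 < ε n := fun n => by positivity
  have hlim : ∀ x, Tendsto (fun n => shiftedConeSup α (ε n) (f n) x) atTop
      (𝓝 (nontangentialMaximal α w x)) := fun x =>
    tendsto_shiftedConeSup hα (fun n => (hfc n).measurable) hfi hf0 hmono hsup hε0
      tendsto_one_div_add_atTop_nhds_zero_nat (hfin x)
  choose L _ hL using fun n => exists_lipschitzWith_poissonIntegral_shiftedConeSup (α := α)
    (hfi n) (hε0 n)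
  have hE : ∀ (K : ℝ≥0) n, ∫⁻ x, (‖deriv (shiftedConeSup α (ε n) (f n)) x‖ₑ - K) ≤
      ∫⁻ x, (‖v x‖ₑ - K) := fun K n => by
    refine lintegral_deriv_shiftedConeSup_tsub_le (hfi n) (hf0 n) (hfA n) hα (hε0 n) fun h hh => ?_
    refine lintegral_slope_tsub_le hv.1 hh (ae_of_all _ fun x => ?_) K
    refine le_trans ?_ (hwv x (x + h) (by linarith))
    rw [enorm_le_iff_norm_le, Real.norm_eq_abs]
    refine (abs_max_sub_max_le_abs _ _ _).trans ?_
    rw [sub_sub_sub_cancel_right]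
    exact abs_norm_sub_norm_le _ _
  have hac := absolutelyContinuousOnInterval_of_tendsto hL hlim hE
    (tendsto_lintegral_enorm_tsub hp1 hp hv)
  have hd : ∀ᵐ x, DifferentiableAt ℝ (nontangentialMaximal α w) x := by
    have : ∀ᵐ x, ∀ n : ℕ, x ∈ uIcc (-(n : ℝ)) n → DifferentiableAt ℝ (nontangentialMaximal α w) x :=
      ae_all_iff.2 fun n => (hac _ _).ae_differentiableAt
    filter_upwards [this] with x hx
    obtain ⟨n, hn⟩ := exists_nat_gt |x|
    refine hx n ?_
    rw [uIcc_of_le (by linarith [abs_nonneg x])]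
    exact abs_le.1 hn.le
  exact ⟨⟨B, hbdd⟩, hac, fun K => lintegral_deriv_tsub_le_of_tendsto hL hlim
    (AbsolutelyContinuousOnInterval.continuous_of_forall hac) hd (hE K)⟩

/-! ### The Lipschitz case, for `p = ∞`. -/

/-- The maximal operator commutes with translations and is monotone, and adding a constant raises it
by at most that constant. Translates of `‖w‖` differ by at most `L` times the shift. -/
theorem lipschitzWith_nontangentialMaximal {L : ℝ≥0} (hw : ∀ a b, ‖w b - w a‖ₑ ≤ L * ‖b - a‖ₑ)
    (hfin : ∀ x, nontangentialMaximalENN α w x < ⊤) :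
    LipschitzWith L (nontangentialMaximal α w) := by
  refine LipschitzWith.of_le_add_mul _ fun x y => ?_
  have h1 : nontangentialMaximalENN α w x ≤
      nontangentialMaximalENN α w y + L * ‖x - y‖ₑ := by
    simp only [nontangentialMaximalENN_eq_coneSup]
    have e : x = y + (x - y) := by ring
    conv_lhs => rw [e]
    rw [coneSup_add_left]
    refine (coneSup_mono_ae (ae_of_all _ fun z => ?_) y).trans (coneSup_add_const_le _ _ y)
    have h2 := enorm_add_le (w z) (w (z + (x - y)) - w z)
    rw [add_sub_cancel] at h2
    refine h2.trans (add_le_add_right ?_ _)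
    simpa using hw z (z + (x - y))
  have h2 := ENNReal.toReal_mono (ENNReal.add_ne_top.2 ⟨(hfin y).ne,
    ENNReal.mul_ne_top ENNReal.coe_ne_top enorm_ne_top⟩) h1
  rwa [ENNReal.toReal_add (hfin y).ne (ENNReal.mul_ne_top ENNReal.coe_ne_top enorm_ne_top),
    ENNReal.toReal_mul, ENNReal.coe_toReal, toReal_enorm, ← dist_eq_norm] at h2

theorem enorm_sub_le_of_forall_setLIntegral
    (hwv : ∀ a b, a ≤ b → ‖w b - w a‖ₑ ≤ ∫⁻ s in Ioc a b, ‖v s‖ₑ) (a b : ℝ) :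
    ‖w b - w a‖ₑ ≤ eLpNorm v ⊤ volume * ‖b - a‖ₑ := by
  wlog hab : a ≤ b generalizing a b
  · have := this b a (le_of_not_ge hab)
    rwa [← edist_eq_enorm_sub, edist_comm, edist_eq_enorm_sub, ← edist_eq_enorm_sub b a, edist_comm,
      edist_eq_enorm_sub]
  · calc ‖w b - w a‖ₑ ≤ ∫⁻ s in Ioc a b, ‖v s‖ₑ := hwv a b hab
      _ ≤ ∫⁻ _ in Ioc a b, eLpNorm v ⊤ volume := by
          refine lintegral_mono_ae (ae_restrict_of_ae ?_)
          rw [eLpNorm_exponent_top]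
          exact enorm_ae_le_eLpNormEssSup v volume
      _ = _ := by
          rw [setLIntegral_const, Real.volume_Ioc, Real.enorm_eq_ofReal (by linarith)]

end

/-! ### Data of bounded variation. -/

theorem eVariationOn_univ_le_of_forall_Icc {E : Type*} [PseudoEMetricSpace E] {f : ℝ → E}
    {c : ℝ≥0∞} {R : ℝ} (h : ∀ r, R ≤ r → eVariationOn f (Icc (-r) r) ≤ c) :
    eVariationOn f univ ≤ c := by
  rw [eVariationOn.eq_biSup_inter_Icc]
  refine iSup₂_le fun p _ => ?_
  refine (eVariationOn.mono f ?_).trans (h (max R (max |p.1| |p.2|)) (le_max_left _ _))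
  rintro x ⟨-, hx1, hx2⟩
  have h1 : |p.1| ≤ max R (max |p.1| |p.2|) := (le_max_left _ _).trans (le_max_right _ _)
  have h2 : |p.2| ≤ max R (max |p.1| |p.2|) := (le_max_right _ _).trans (le_max_right _ _)
  exact ⟨by linarith [neg_abs_le p.1], by linarith [le_abs_self p.2]⟩

theorem eVariationOn_indicator_Icc_le {f : ℝ → ℝ} (hf0 : ∀ x, 0 ≤ f x) {n : ℝ} (hn : 0 ≤ n) :
    eVariationOn ((Icc (-n) n).indicator f) univ ≤
      eVariationOn f univ + ENNReal.ofReal (f n) + ENNReal.ofReal (f (-n)) := by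
  set g := (Icc (-n) n).indicator f with hg
  have hgn : g n = f n := indicator_of_mem (by exact ⟨by linarith, le_rfl⟩) f
  have hgn' : g (-n) = f (-n) := indicator_of_mem (by exact ⟨le_rfl, by linarith⟩) f
  have hg0 : ∀ x, 0 ≤ g x := fun x => indicator_nonneg (fun _ _ => hf0 _) x
  have hgl : ∀ x, x < -n → g x = 0 := fun x hx => indicator_of_notMem (fun h => by linarith [h.1]) f
  have hgr : ∀ x, n < x → g x = 0 := fun x hx => indicator_of_notMem (fun h => by linarith [h.2]) f
  refine eVariationOn_univ_le_of_forall_Icc (R := n) fun r hr => ?_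
  have hl : eVariationOn g (Icc (-r) (-n)) ≤ ENNReal.ofReal (f (-n)) := by
    have hmono : MonotoneOn g (Icc (-r) (-n)) := by
      intro x hx y hy hxy
      rcases hx.2.eq_or_lt with rfl | hlt
      · rw [le_antisymm hxy hy.2]
      · rw [hgl x hlt]
        exact hg0 y
    have := (hmono.eVariationOn_eq (left_mem_Icc.2 (by linarith))
      (right_mem_Icc.2 (by linarith))).le
    rw [inter_self, hgn'] at this
    exact this.trans (ENNReal.ofReal_le_ofReal (by linarith [hg0 (-r)]))
  have hr' : eVariationOn g (Icc n r) ≤ ENNReal.ofReal (f n) := by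
    have hmono : MonotoneOn (fun x => g (-x)) (Icc (-r) (-n)) := by
      intro x hx y hy hxy
      rcases hx.2.eq_or_lt with rfl | hlt
      · rw [le_antisymm hxy hy.2]
      · simp only [hgr (-x) (by linarith)]
        exact hg0 _
    have h1 := (hmono.eVariationOn_eq (left_mem_Icc.2 (by linarith))
      (right_mem_Icc.2 (by linarith))).le
    rw [inter_self, neg_neg, hgn] at h1
    have h2 := eVariationOn.comp_le_of_antitoneOn (fun x => g (-x)) (s := Icc (-r) (-n))
      (t := Icc n r) (fun x => -x) (fun x _ y _ hxy => neg_le_neg hxy)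
      (fun x hx => ⟨by linarith [hx.2], by linarith [hx.1]⟩)
    have e : ((fun x => g (-x)) ∘ fun x => -x) = g := funext fun x => by simp
    rw [e] at h2
    exact h2.trans (h1.trans (ENNReal.ofReal_le_ofReal (by linarith [hg0 (- -r)])))
  have hm : eVariationOn g (Icc (-n) n) ≤ eVariationOn f univ := by
    rw [eVariationOn.congr (g := f) fun x hx => indicator_of_mem hx f]
    exact eVariationOn.mono f (subset_univ _)
  have h1 := eVariationOn.Icc_add_Icc g (s := univ) (a := -r) (b := -n) (c := n) (by linarith)
    (by linarith) (mem_univ _)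
  have h2 := eVariationOn.Icc_add_Icc g (s := univ) (a := -r) (b := n) (c := r) (by linarith)
    (by linarith) (mem_univ _)
  simp only [univ_inter] at h1 h2
  rw [← h2, ← h1]
  calc _ ≤ ENNReal.ofReal (f (-n)) + eVariationOn f univ + ENNReal.ofReal (f n) := by gcongr
    _ = _ := by ring

/-- The increments of `f` are dominated by those of its variation function `V`. The integral of `V
(x + h) - V x` over `[-n, n]` telescopes to two end pieces of length `h`, whose difference is at
most `h` times the total variation. -/
theorem lintegral_slope_le_eVariationOn {f : ℝ → ℝ} {h : ℝ} (hh : 0 < h) :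
    ∫⁻ x, ‖h⁻¹ • (f (x + h) - f x)‖ₑ ≤ eVariationOn f univ := by
  by_cases hbv : eVariationOn f univ = ⊤
  · simp [hbv]
  have hb : BoundedVariationOn f univ := hbv
  have hl := hb.locallyBoundedVariationOn
  set V : ℝ → ℝ := variationOnFromTo f univ 0 with hV
  have hVm : Monotone V := fun x y hxy =>
    variationOnFromTo.monotoneOn hl (mem_univ 0) (mem_univ x) (mem_univ y) hxy
  have hVi : ∀ a b, IntervalIntegrable V volume a b := fun a b => hVm.intervalIntegrable
  have hVh : Monotone fun x => V (x + h) := fun x y hxy => hVm (by linarith)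
  have hVb : ∀ a b, V a - V b ≤ (eVariationOn f univ).toReal := fun a b => by
    rw [hV, variationOnFromTo.sub_right hl (mem_univ _) (mem_univ _) (mem_univ _)]
    exact (le_abs_self _).trans (variationOnFromTo.abs_le_eVariationOn hb)
  have hfin : ∀ n : ℕ, ∫⁻ x in Ioc (-(n : ℝ)) n, ‖h⁻¹ • (f (x + h) - f x)‖ₑ ≤
      eVariationOn f univ := by
    intro n
    have hn : -(n : ℝ) ≤ n := by linarith [Nat.cast_nonneg (α := ℝ) n]
    have hi : IntervalIntegrable (fun x => V (x + h) - V x) volume (-(n : ℝ)) n :=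
      (hVh.intervalIntegrable).sub (hVi _ _)
    calc ∫⁻ x in Ioc (-(n : ℝ)) n, ‖h⁻¹ • (f (x + h) - f x)‖ₑ
        ≤ ∫⁻ x in Ioc (-(n : ℝ)) n, ENNReal.ofReal h⁻¹ * ENNReal.ofReal (V (x + h) - V x) := by
          refine lintegral_mono fun x => ?_
          simp only
          rw [enorm_smul, Real.enorm_eq_ofReal (by positivity), Real.enorm_eq_ofReal_abs]
          gcongr
          exact variationOnFromTo.abs_sub_le_sub_of_le hl (mem_univ _) (mem_univ _) (mem_univ _)
            (by linarith)
      _ = ENNReal.ofReal h⁻¹ * ENNReal.ofReal (∫ x in (-(n : ℝ))..n, (V (x + h) - V x)) := by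
          rw [lintegral_const_mul' _ _ ENNReal.ofReal_ne_top, intervalIntegral.integral_of_le hn,
            ofReal_integral_eq_lintegral_ofReal hi.1]
          exact ae_of_all _ fun x => sub_nonneg.2 (hVm (by linarith))
      _ ≤ ENNReal.ofReal h⁻¹ * ENNReal.ofReal (h * (eVariationOn f univ).toReal) := by
          gcongr
          rw [intervalIntegral.integral_sub hVh.intervalIntegrable (hVi _ _),
            intervalIntegral.integral_comp_add_right,
            intervalIntegral.integral_interval_sub_interval_comm' (hVi _ _) (hVi _ _) (hVi _ _)]
          have e1 : ∫ x in (n : ℝ)..(n + h), V x = ∫ x in (0 : ℝ)..h, V (x + n) := by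
            rw [intervalIntegral.integral_comp_add_right, zero_add, add_comm]
          have e2 : ∫ x in (-(n : ℝ))..(-n + h), V x = ∫ x in (0 : ℝ)..h, V (x + -n) := by
            rw [intervalIntegral.integral_comp_add_right, zero_add, add_comm]
          have hs : ∀ c : ℝ, IntervalIntegrable (fun x => V (x + c)) volume 0 h := fun c =>
            Monotone.intervalIntegrable fun x y hxy => hVm (by linarith)
          rw [e1, e2]
          have h1 := intervalIntegral.integral_mono_on (μ := volume) hh.le ((hs n).sub (hs (-n)))
            (intervalIntegrable_const (c := (eVariationOn f univ).toReal)) fun x _ => hVb _ _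
          rw [intervalIntegral.integral_sub (hs n) (hs (-n)), intervalIntegral.integral_const,
            sub_zero, smul_eq_mul] at h1
          linarith
      _ = eVariationOn f univ := by
          rw [← ENNReal.ofReal_mul (by positivity), ← mul_assoc, inv_mul_cancel₀ hh.ne', one_mul,
            ENNReal.ofReal_toReal hbv]
  have hU : ⋃ n : ℕ, Ioc (-(n : ℝ)) n = univ := by
    refine eq_univ_of_forall fun x => ?_
    obtain ⟨n, hn⟩ := exists_nat_gt |x|
    exact mem_iUnion.2 ⟨n, (abs_lt.1 hn).1, (abs_lt.1 hn).2.le⟩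
  have e : ∫⁻ x, ‖h⁻¹ • (f (x + h) - f x)‖ₑ =
      ∫⁻ x in ⋃ n : ℕ, Ioc (-(n : ℝ)) n, ‖h⁻¹ • (f (x + h) - f x)‖ₑ := by
    rw [hU, setLIntegral_univ]
  rw [e, setLIntegral_iUnion_of_directed]
  · exact iSup_le hfin
  · refine directed_of_isDirected_le fun m n hmn => Ioc_subset_Ioc ?_ ?_
    · exact neg_le_neg (by exact_mod_cast hmn)
    · exact_mod_cast hmn

/-- Beyond `x` and before `-x` the function must still descend arbitrarily close to zero, which
costs at least `f x` and `f (-x)`. This gain offsets the jumps counted in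
`eVariationOn_indicator_Icc_le`. -/
theorem eVariationOn_add_le_of_forall {f : ℝ → ℝ}
    (hf : ∀ δ > 0, ∃ R, ∀ x, R < |x| → f x < δ) {x : ℝ} (hx : 0 ≤ x) :
    eVariationOn f (Icc (-x) x) + (ENNReal.ofReal (f x) + ENNReal.ofReal (f (-x))) ≤
      eVariationOn f univ := by
  refine ENNReal.le_of_forall_pos_le_add fun ε hε _ => ?_
  obtain ⟨R, hR⟩ := hf (ε / 2) (by positivity)
  set y := max x (|R| + 1) with hy
  have hxy : x ≤ y := le_max_left _ _
  have hRy : R < y := (le_abs_self R).trans_lt ((lt_add_one _).trans_le (le_max_right _ _))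
  have hstep : ∀ a b, R < |b| → ENNReal.ofReal (f a) ≤ edist (f a) (f b) + ENNReal.ofReal (ε / 2) := by
    intro a b hb
    rw [edist_dist, ← ENNReal.ofReal_add dist_nonneg (by positivity), Real.dist_eq]
    refine ENNReal.ofReal_le_ofReal ?_
    linarith [le_abs_self (f a - f b), hR b hb]
  have h1 := hstep x y (by rwa [abs_of_nonneg (hx.trans hxy)])
  have h2 := hstep (-x) (-y) (by rwa [abs_neg, abs_of_nonneg (hx.trans hxy)])
  have e1 : edist (f x) (f y) ≤ eVariationOn f (Icc x y) :=
    eVariationOn.edist_le f (left_mem_Icc.2 hxy) (right_mem_Icc.2 hxy)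
  have e2 : edist (f (-x)) (f (-y)) ≤ eVariationOn f (Icc (-y) (-x)) :=
    eVariationOn.edist_le f (right_mem_Icc.2 (neg_le_neg hxy)) (left_mem_Icc.2 (neg_le_neg hxy))
  have s1 := eVariationOn.Icc_add_Icc f (s := univ) (a := -y) (b := -x) (c := x) (by linarith)
    (by linarith) (mem_univ _)
  have s2 := eVariationOn.Icc_add_Icc f (s := univ) (a := -y) (b := x) (c := y) (by linarith)
    (by linarith) (mem_univ _)
  simp only [univ_inter] at s1 s2
  have hεe : ENNReal.ofReal (ε / 2) + ENNReal.ofReal (ε / 2) = ε := by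
    rw [← ENNReal.ofReal_add (by positivity) (by positivity), add_halves, ENNReal.ofReal_coe_nnreal]
  calc _ ≤ eVariationOn f (Icc (-x) x) + ((eVariationOn f (Icc x y) + ENNReal.ofReal (ε / 2)) +
        (eVariationOn f (Icc (-y) (-x)) + ENNReal.ofReal (ε / 2))) := by
        gcongr
        · exact h1.trans (by gcongr)
        · exact h2.trans (by gcongr)
    _ = eVariationOn f (Icc (-y) (-x)) + eVariationOn f (Icc (-x) x) + eVariationOn f (Icc x y) +
        (ENNReal.ofReal (ε / 2) + ENNReal.ofReal (ε / 2)) := by ring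
    _ ≤ _ := by
        rw [s1, s2, hεe]
        gcongr
        exact eVariationOn.mono f (subset_univ _)

section
variable {α : ℝ}

theorem tendsto_poissonAverage_of_tendsto {F : ℝ → ℝ≥0∞} (hFm : Measurable F) {B : ℝ≥0}
    (hB : ∀ x, F x ≤ B) {l : Filter ℝ} [l.IsCountablyGenerated] {c : ℝ≥0∞}
    (hl : ∀ z, Tendsto (fun x => F (z + x)) l (𝓝 c)) :
    Tendsto (fun x => poissonAverage F x 1) l (𝓝 c) := by
  have hc := poissonAverage_const c 0 one_pos
  have e : (fun x => poissonAverage F x 1) = fun x => poissonAverage (fun z => F (z + x)) 0 1 :=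
    funext fun x => by rw [← poissonAverage_add_left, zero_add]
  have hB1 := poissonAverage_const (B : ℝ≥0∞) 0 one_pos
  rw [e, ← hc]
  unfold poissonAverage at hB1 ⊢
  have hP := measurable_ofReal_poissonKernel1D 0 one_pos
  refine tendsto_lintegral_filter_of_dominated_convergence
    (fun z => ENNReal.ofReal (poissonKernel1D (0 - z) 1) * B) ?_ ?_ ?_ ?_
  · exact Eventually.of_forall fun x => hP.mul (hFm.comp (measurable_id.add_const x))
  · exact Eventually.of_forall fun x => ae_of_all _ fun z => mul_le_mul_right (hB _) _
  · rw [hB1]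
    exact ENNReal.coe_ne_top
  · exact ae_of_all _ fun z => ENNReal.Tendsto.const_mul (hl z) (Or.inr ENNReal.ofReal_ne_top)

theorem BoundedVariationOn.measurable_univ {f : ℝ → ℝ} (hf : BoundedVariationOn f univ) :
    Measurable f := by
  obtain ⟨p, q, hp, hq, rfl⟩ := hf.locallyBoundedVariationOn.exists_monotoneOn_sub_monotoneOn
  exact (monotoneOn_univ.1 hp).measurable.sub (monotoneOn_univ.1 hq).measurable

/-- Lower semicontinuity of the variation, with a convergent extra term kept on the left. -/
theorem eVariationOn_add_le_of_tendsto {M : ℝ → ℝ} {Mn : ℕ → ℝ → ℝ} {s : Set ℝ}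
    (hlim : ∀ x, Tendsto (fun n => Mn n x) atTop (𝓝 (M x))) {d c : ℝ≥0∞} {dn cn : ℕ → ℝ≥0∞}
    (hd : Tendsto dn atTop (𝓝 d)) (hc : Tendsto cn atTop (𝓝 c)) (hd' : d ≠ ⊤)
    (h : ∀ n, eVariationOn (Mn n) s + dn n ≤ cn n) : eVariationOn M s + d ≤ c := by
  refine add_le_of_le_tsub_right_of_le
    (le_of_tendsto_of_tendsto hd hc (Eventually.of_forall fun n => le_add_self.trans (h n)))
    (le_of_forall_lt_imp_le_of_dense fun v hv => ?_)
  refine ENNReal.le_sub_of_add_le_right hd' ?_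
  refine le_of_tendsto_of_tendsto (hd.const_add v) hc ?_
  filter_upwards [eVariationOn.lowerSemicontinuous_aux (fun x _ => hlim x) hv] with n hn
  exact (add_le_add_left hn.le _).trans (h n)

/-- A direct limit of the truncations would give the variation of `f` plus its two limits `L₁`, `L₂`
at infinity. The extra terms are matched on the left by end values of the maximal function and then
cancelled. -/
theorem nontangentialMaximal_boundedVariation {E : Type*} [NormedAddCommGroup E] {u : ℝ → E}
    (hα : 0 ≤ α) (hu : BoundedVariationOn u univ) :
    (∀ x, nontangentialMaximalENN α u x < ⊤) ∧
      eVariationOn (nontangentialMaximal α u) univ ≤ eVariationOn u univ := by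
  set f : ℝ → ℝ := fun x => ‖u x‖ with hf
  have hfu : eVariationOn f univ ≤ eVariationOn u univ := by
    have := (lipschitzWith_one_norm (E := E)).lipschitzOnWith (s := univ) |>.comp_eVariationOn_le
      (f := norm) (s := univ) (g := u) (mapsTo_univ _ _)
    rwa [ENNReal.coe_one, one_mul] at this
  have hfbv : BoundedVariationOn f univ := ne_top_of_le_ne_top hu hfu
  have hf0 : ∀ x, 0 ≤ f x := fun x => norm_nonneg _
  have hfm : Measurable f := hfbv.measurable_univ
  have hfE : ∀ x, ENNReal.ofReal (f x) = ‖u x‖ₑ := fun x => ofReal_norm _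
  obtain ⟨B, hB⟩ : ∃ B : ℝ≥0, ∀ x, f x ≤ B := by
    refine ⟨(f 0 + (eVariationOn f univ).toReal).toNNReal, fun x => ?_⟩
    have := hfbv.sub_le (mem_univ x) (mem_univ 0)
    exact le_trans (by linarith) (Real.le_coe_toNNReal _)
  have hBE : ∀ x, ‖u x‖ₑ ≤ B := fun x => by
    rw [← hfE, ← ENNReal.ofReal_coe_nnreal]
    exact ENNReal.ofReal_le_ofReal (hB x)
  have hfin : ∀ x, nontangentialMaximalENN α u x < ⊤ := fun x =>
    (coneSup_le_const (ae_of_all _ hBE) x).trans_lt ENNReal.coe_lt_top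
  refine ⟨hfin, ?_⟩
  refine le_trans ?_ hfu
  set M := nontangentialMaximal α u with hM
  obtain ⟨L₁, hL₁⟩ := hfbv.exists_tendsto_atTop
  obtain ⟨L₂, hL₂⟩ := hfbv.exists_tendsto_atBot
  simp only [principal_univ, top_inf_eq] at hL₁ hL₂
  set g : ℕ → ℝ → ℝ := fun n => (Icc (-(n : ℝ)) n).indicator f with hg
  have hgm : ∀ n, Measurable (g n) := fun n => hfm.indicator measurableSet_Icc
  have hg0 : ∀ n z, 0 ≤ g n z := fun n z => indicator_nonneg (fun _ _ => hf0 _) z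
  have hgi : ∀ n, Integrable (g n) := fun n => by
    rw [hg, integrable_indicator_iff measurableSet_Icc]
    refine Integrable.mono' (g := fun _ => (B : ℝ)) (integrableOn_const (by simp))
      hfm.aestronglyMeasurable (ae_of_all _ fun x => ?_)
    rw [Real.norm_eq_abs, abs_of_nonneg (hf0 x)]
    exact hB x
  have hgA : ∀ (n : ℕ) (z : ℝ), (n : ℝ) < |z| → g n z = 0 := fun n z hz =>
    indicator_of_notMem (fun h : z ∈ Icc (-(n : ℝ)) n => absurd (abs_le.2 h) (not_le.2 hz)) f
  have hmono : Monotone g := fun m n hmn z =>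
    indicator_le_indicator_of_subset (Icc_subset_Icc (neg_le_neg (by exact_mod_cast hmn))
      (by exact_mod_cast hmn)) hf0 z
  have hsup : ∀ z, ⨆ n, ENNReal.ofReal (g n z) = ‖u z‖ₑ := fun z => by
    rw [← hfE]
    refine iSup_ofReal_eq_of_tendsto (fun m n hmn => hmono hmn z) (tendsto_const_nhds.congr' ?_)
    obtain ⟨N, hN⟩ := exists_nat_gt |z|
    filter_upwards [eventually_ge_atTop N] with n hn
    refine (indicator_of_mem ?_ f).symm
    exact abs_le.1 (hN.le.trans (by exact_mod_cast hn))
  set ε : ℕ → ℝ := fun n => 1 / ((n : ℝ) + 1) with hε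
  have hε0 : ∀ n, 0 < ε n := fun n => by positivity
  set Mn : ℕ → ℝ → ℝ := fun n => shiftedConeSup α (ε n) (g n) with hMn
  have hlim : ∀ x, Tendsto (fun n => Mn n x) atTop (𝓝 (M x)) := fun x =>
    tendsto_shiftedConeSup hα hgm hgi hg0 hmono hsup hε0
      tendsto_one_div_add_atTop_nhds_zero_nat (hfin x)
  have hvar : ∀ n, eVariationOn (Mn n) univ ≤
      eVariationOn f univ + ENNReal.ofReal (f n) + ENNReal.ofReal (f (-n)) := fun n => by
    obtain ⟨L, -, hL⟩ := exists_lipschitzWith_poissonIntegral_shiftedConeSup (α := α)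
      (hgi n) (hε0 n)
    refine hL.eVariationOn_le_lintegral_deriv.trans
      (le_trans ?_ (eVariationOn_indicator_Icc_le hf0 n.cast_nonneg))
    have := lintegral_deriv_shiftedConeSup_tsub_le (hgi n) (hg0 n) (hgA n) hα (hε0 n) (K := 0)
      (E := eVariationOn (g n) univ) fun h hh => by
        simpa using lintegral_slope_le_eVariationOn (f := g n) hh
    simpa using this
  have hnat : Tendsto (fun n : ℕ => (n : ℝ)) atTop atTop := tendsto_natCast_atTop_atTop
  -- The limit in `n` is taken with `x` fixed, so the end values of `M` on the left survive
  -- alongside `L₁` and `L₂` on the right.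
  have key : ∀ x, 0 ≤ x → eVariationOn M (Icc (-x) x) + (ENNReal.ofReal (M x) +
      ENNReal.ofReal (M (-x))) ≤ eVariationOn f univ + ENNReal.ofReal L₁ + ENNReal.ofReal L₂ := by
    intro x hx
    refine eVariationOn_add_le_of_tendsto hlim
      ((ENNReal.tendsto_ofReal (hlim x)).add (ENNReal.tendsto_ofReal (hlim (-x))))
      ((tendsto_const_nhds.add (ENNReal.tendsto_ofReal (hL₁.comp hnat))).add
        (ENNReal.tendsto_ofReal (hL₂.comp (tendsto_neg_atTop_atBot.comp hnat))))
      (by simp) fun n => ?_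
    refine (eVariationOn_add_le_of_forall (fun δ hδ => ?_) hx).trans (hvar n)
    obtain ⟨R, -, hR⟩ := exists_shiftedConeSup_lt (hgi n) (hg0 n) (hgA n) hα (hε0 n) hδ
    exact ⟨R, hR⟩
  have hFm : Measurable fun z => ‖u z‖ₑ := by
    simp_rw [← hfE]
    exact hfm.ennreal_ofReal
  -- Any fixed height would do: the average at height 1 bounds `M` below and has the limits `L₁` and
  -- `L₂` at `±∞`.
  have hMge : ∀ x, poissonAverage (fun z => ‖u z‖ₑ) x 1 ≤ ENNReal.ofReal (M x) := fun x => by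
    rw [hM, nontangentialMaximal, ENNReal.ofReal_toReal (hfin x).ne]
    exact poissonAverage_le_coneSup _ one_pos (by simpa using hα)
  have htop := tendsto_poissonAverage_of_tendsto hFm hBE (l := atTop) (c := ENNReal.ofReal L₁)
    fun z => by
      simp_rw [← hfE]
      exact ENNReal.tendsto_ofReal (hL₁.comp (tendsto_atTop_add_const_left _ z tendsto_id))
  have hbot := tendsto_poissonAverage_of_tendsto hFm hBE (l := atBot) (c := ENNReal.ofReal L₂)
    fun z => by
      simp_rw [← hfE]
      exact ENNReal.tendsto_ofReal (hL₂.comp (tendsto_atBot_add_const_left _ z tendsto_id))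
  refine eVariationOn_univ_le_of_forall_Icc (R := 0) fun r hr => ?_
  have hlow := tendsto_const_nhds (x := eVariationOn M (Icc (-r) r)) |>.add
    (htop.add (hbot.comp tendsto_neg_atTop_atBot))
  have hfinal : eVariationOn M (Icc (-r) r) + (ENNReal.ofReal L₁ + ENNReal.ofReal L₂) ≤
      eVariationOn f univ + (ENNReal.ofReal L₁ + ENNReal.ofReal L₂) := by
    rw [← add_assoc (eVariationOn f univ)]
    refine le_of_tendsto hlow ?_
    filter_upwards [eventually_ge_atTop r] with x hx
    refine le_trans ?_ (key x (hr.trans hx))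
    exact add_le_add (eVariationOn.mono M (Icc_subset_Icc (by linarith) hx))
      (add_le_add (hMge x) (hMge (-x)))
  exact (ENNReal.add_le_add_iff_right (by simp)).1 hfinal

end

/-! ### Reduction to continuous representatives and conclusion. -/

section
variable {𝕜 : Type*} [RCLike 𝕜] {α : ℝ} {u v : ℝ → 𝕜} {p : ℝ≥0∞}

theorem nontangentialMaximalENN_congr_ae {w : ℝ → 𝕜} (h : u =ᵐ[volume] w) :
    nontangentialMaximalENN α u = nontangentialMaximalENN α w :=
  funext fun x => coneSup_congr_ae (h.mono fun z hz => by simp only [hz]) x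

theorem nontangentialMaximal_congr_ae {w : ℝ → 𝕜} (h : u =ᵐ[volume] w) :
    nontangentialMaximal α u = nontangentialMaximal α w :=
  funext fun x => congrArg ENNReal.toReal (congrFun (nontangentialMaximalENN_congr_ae h) x)

theorem memLp_top_nontangentialMaximal {B : ℝ≥0} (hB : ∀ x, nontangentialMaximalENN α u x ≤ B)
    (hm : Measurable (nontangentialMaximal α u)) : MemLp (nontangentialMaximal α u) ⊤ volume := by
  refine memLp_top_of_bound hm.aestronglyMeasurable B (ae_of_all _ fun x => ?_)
  rw [Real.norm_eq_abs, abs_of_nonneg (show 0 ≤ nontangentialMaximal α u x from ENNReal.toReal_nonneg)]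
  exact ENNReal.toReal_le_coe_of_le_coe (hB x)

/-- The maximal function ignores null sets, so `u` may be replaced by its continuous primitive
representative. For `p = ∞` that representative is Lipschitz but need not vanish at infinity, hence
the separate argument. -/
theorem nontangentialMaximal_sobolev (hα : 0 ≤ α) (hp1 : 1 ≤ p) (hu : MemLp u p volume)
    (hv : MemLp v p volume) (huv : HasWeakDeriv u v) :
    (∃ B : ℝ≥0, ∀ x, nontangentialMaximalENN α u x ≤ B) ∧
    Continuous (nontangentialMaximal α u) ∧
    HasWeakDeriv (nontangentialMaximal α u) (deriv (nontangentialMaximal α u)) ∧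
    eLpNorm (deriv (nontangentialMaximal α u)) p volume ≤ eLpNorm v p volume := by
  obtain ⟨w, hwc, huw, hwv⟩ := huv.exists_continuous_ae_eq
  rw [nontangentialMaximal_congr_ae huw, nontangentialMaximalENN_congr_ae huw]
  have hw : MemLp w p volume := (memLp_congr_ae huw).1 hu
  by_cases hp : p = ⊤
  · subst hp
    have hL : eLpNorm v ⊤ volume = ((eLpNorm v ⊤ volume).toNNReal : ℝ≥0∞) :=
      (ENNReal.coe_toNNReal hv.2.ne).symm
    set L := (eLpNorm v ⊤ volume).toNNReal with hLdef
    obtain ⟨B, hB⟩ : ∃ B : ℝ≥0, ∀ x, nontangentialMaximalENN α w x ≤ B := by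
      refine ⟨(eLpNorm w ⊤ volume).toNNReal, fun x => coneSup_le_const ?_ x⟩
      rw [ENNReal.coe_toNNReal hw.2.ne, eLpNorm_exponent_top]
      exact enorm_ae_le_eLpNormEssSup w volume
    have hlip : LipschitzWith L (nontangentialMaximal α w) :=
      lipschitzWith_nontangentialMaximal
        (fun a b => hL ▸ enorm_sub_le_of_forall_setLIntegral hwv a b)
        fun x => (hB x).trans_lt ENNReal.coe_lt_top
    refine ⟨⟨B, hB⟩, hlip.continuous, AbsolutelyContinuousOnInterval.hasWeakDeriv_deriv fun a b =>
      (hlip.lipschitzOnWith (s := uIcc a b)).absolutelyContinuousOnInterval, ?_⟩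
    rw [hL, eLpNorm_exponent_top]
    refine eLpNormEssSup_le_of_ae_nnnorm_bound (ae_of_all _ fun x => ?_)
    exact norm_deriv_le_of_lipschitz hlip
  · obtain ⟨hB, hac, hmaj⟩ := nontangentialMaximal_sobolev_of_continuous hα hp1 hp hwc hw hv hwv
    exact ⟨hB, AbsolutelyContinuousOnInterval.continuous_of_forall hac,
      AbsolutelyContinuousOnInterval.hasWeakDeriv_deriv hac,
      eLpNorm_le_of_forall_lintegral_tsub_le (measurable_deriv _).aestronglyMeasurable hv.1 hp1 hp
        hmaj⟩

theorem eLpNorm_weakDeriv_nontangentialMaximal_le (hα : 0 ≤ α) (hp1 : 1 ≤ p) (hu : MemW1p u p)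
    {w : ℝ → ℝ} (hv : HasWeakDeriv u v) (hw : HasWeakDeriv (nontangentialMaximal α u) w) :
    eLpNorm w p volume ≤ eLpNorm v p volume := by
  obtain ⟨hup, v', hv', hvp⟩ := hu
  obtain ⟨-, -, hd, hle⟩ := nontangentialMaximal_sobolev hα hp1 hup hvp hv'
  rwa [eLpNorm_congr_ae (hw.ae_eq hd), eLpNorm_congr_ae (hv.ae_eq hv')]

end

theorem theorem4 {𝕜 : Type*} [RCLike 𝕜] (α : ℝ) (hα : 0 ≤ α) :
    -- (i)
    (∀ (p : ℝ≥0∞) (u₀ : ℝ → 𝕜), 1 < p → MemW1p u₀ p →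
      (∀ x, nontangentialMaximalENN α u₀ x < ⊤) ∧
      MemW1p (nontangentialMaximal α u₀) p ∧
      ∀ (v : ℝ → 𝕜) (w : ℝ → ℝ), HasWeakDeriv u₀ v →
        HasWeakDeriv (nontangentialMaximal α u₀) w →
        eLpNorm w p volume ≤ eLpNorm v p volume) ∧
    -- (ii)
    (∀ u₀ : ℝ → 𝕜, MemW1p u₀ 1 →
      (∀ x, nontangentialMaximalENN α u₀ x < ⊤) ∧
      MemLp (nontangentialMaximal α u₀) ⊤ volume ∧
      (∃ w : ℝ → ℝ, HasWeakDeriv (nontangentialMaximal α u₀) w) ∧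
      ∀ (v : ℝ → 𝕜) (w : ℝ → ℝ), HasWeakDeriv u₀ v →
        HasWeakDeriv (nontangentialMaximal α u₀) w →
        eLpNorm w 1 volume ≤ eLpNorm v 1 volume) ∧
    -- (iii)
    (∀ u₀ : ℝ → 𝕜, BoundedVariationOn u₀ univ →
      (∀ x, nontangentialMaximalENN α u₀ x < ⊤) ∧
      BoundedVariationOn (nontangentialMaximal α u₀) univ ∧
      eVariationOn (nontangentialMaximal α u₀) univ ≤ eVariationOn u₀ univ) := by
  refine ⟨fun p u₀ hp hu => ?_, fun u₀ hu => ?_, fun u₀ hu => ?_⟩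
  · have hu' := hu
    obtain ⟨hup, v, hv, hvp⟩ := hu'
    obtain ⟨⟨B, hB⟩, hc, hd, hle⟩ := nontangentialMaximal_sobolev hα hp.le hup hvp hv
    have hfin : ∀ x, nontangentialMaximalENN α u₀ x < ⊤ := fun x =>
      (hB x).trans_lt ENNReal.coe_lt_top
    refine ⟨hfin, ⟨?_, _, hd, (measurable_deriv _).aestronglyMeasurable, hle.trans_lt hvp.2⟩,
      fun v w hv hw => eLpNorm_weakDeriv_nontangentialMaximal_le hα hp.le hu hv hw⟩
    by_cases hpt : p = ⊤
    · exact hpt ▸ memLp_top_nontangentialMaximal hB hc.measurable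
    · exact memLp_nontangentialMaximal hα hp hpt hup hfin hc.measurable
  · have hu' := hu
    obtain ⟨hup, v, hv, hvp⟩ := hu'
    obtain ⟨⟨B, hB⟩, hc, hd, -⟩ := nontangentialMaximal_sobolev hα le_rfl hup hvp hv
    exact ⟨fun x => (hB x).trans_lt ENNReal.coe_lt_top,
      memLp_top_nontangentialMaximal hB hc.measurable, ⟨_, hd⟩,
      fun v w hv hw => eLpNorm_weakDeriv_nontangentialMaximal_le hα le_rfl hu hv hw⟩
  · obtain ⟨hfin, hle⟩ := nontangentialMaximal_boundedVariation hα hu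
    exact ⟨hfin, ne_top_of_le_ne_top hu hle, hle⟩
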